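/- **Setting.** Let $(M,\rho)$ be a locally compact separable metric space with its Borel $\sigma$-field. For each $n$ let $\mathsf P^{(n)}=(\mathsf P^{(n)}_t)_{t\ge 0}$ be a Feller transition function on $M^n$ (a semigroup of Markov kernels that maps $C_0(M^n)$ into itself and is strongly continuous at $t=0$). Assume: - (TF1) for distinct indices $i_1,\dots,i_k\in\{1,\dots,n\}$, with $\pi(x)=(x_{i_1},\dots,x_{i_k})$: $\mathsf P^{(n)}_t(x,\pi^{-1}B)=\mathsf P^{(k)}_t(\pi x,B)$ for all $t\ge0$, $x\in M^n$ and Borel $B\subset M^k$; - (TF2) $\mathsf P^{(2)}_t((x,x),\{(y,y):y\in M\})=1$ for all $x\in M$, $t\ge 0$; - (TF3) $\lim_{t\downarrow0}t^{-1}\sup_{x\in K}\mathsf P^{(1)}_t(x,\{y:\rho(x,y)>r\})=0$ for all compact $K\subset M$ and $r>0$. Let $F$ be the space of measurable maps $M\to M$ with the cylindrical $\sigma$-field. On a probability space $(\Omega,\mathcal A,\mathbb P)$ let $\psi^0=(\psi^0_{s,t})_{s\le t}$ be a stochastic flow of measurable mappings associated with $(\mathsf P^{(n)})$, that is, a family of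 random elements of $F$ such that - $\mathbb E f(\psi^0_{s,t}(x_1),\dots,\psi^0_{s,t}(x_n))=\mathsf P^{(n)}_{t-s}f(x)$ for $s\le t$, $x\in M^n$, $f\in C_0(M^n)$; - $\psi^0_{s,s}(x)=x$, and there are measurable maps $\mathcal J_t:F\times M\to M$ ($t\ge0$) such that for all $s\le t\le u$ and $x\in M$, a.s. $\mathcal J_{t-s}(\psi^0_{s,t})(x)=\psi^0_{s,t}(x)$ and a.s. $\psi^0_{s,u}(x)=\mathcal J_{u-t}(\psi^0_{t,u})(\psi^0_{s,t}(x))$; - for $t_1\le\dots\le t_n$ the random maps $\psi^0_{t_1,t_2},\dots,\psi^0_{t_{n-1},t_n}$ are independent; - for $f\in C_0(M)$ and $s\le t$: $\lim_{(u,v)\to(s,t),\,u\le v}\sup_x\mathbb E[(f(\psi^0_{u,v}(x))-f(\psi^0_{s,t}(x)))^2]=0$; $\lim_{y\to x}\mathbb E[(f(\psi^0_{s,t}(y))-f(\psi^0_{s,t}(x)))^2]=0$ for all $x\in M$; and $\lim_{y\to\infty}\mathbb E[f(\psi^0_{s,t}(y))^2]=0$. **Paths and skeletons.** Let $X=\bigcup_{s\in\mathbb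 R}C([s,\infty):M)$. For $f\in X$ let $i(f)$ be its starting time and $e(f)(t)=f(i(f)\vee t)$, $t\in\mathbb R$. Let $\delta$ be a distance on $C(\mathbb R:M)$ that metrizes uniform convergence on compact sets, equip $X$ with the distance $|i(f)-i(g)|+\delta(e(f),e(g))$ and its Borel $\sigma$-field, and let $f[s,\infty)\in X$ be the restriction of $e(f)$ to $[s,\infty)$. A sequence $\varphi=(\varphi_n)_{n\in\mathbb N}$ in $X$, with $s_n=i(\varphi_n)$, is a *skeleton* if - whenever $s_m,s_n\le s$ and $\varphi_m(s)=\varphi_n(s)$, then $\varphi_m=\varphi_n$ on $[s,\infty)$; - $\{(s_n,\varphi_n(s_n)):n\in\mathbb N\}$ is dense in $\mathbb R\times M$; - for each compact $L\subset\mathbb R\times M$ the set $\{\varphi_n[s,\infty): s\in\mathbb R,\ n\in\mathbb N,\ s_n\le s,\ (s,\varphi_n(s))\in L\}$ is relatively compact in $X$. Let $((s_n,x_n))_{n\in\mathbb N}$ be dense in $\mathbb R\times M$, and let $\Phi=(\Phi_n)_{n\in\mathbb N}$ be a random element of $X^{\mathbb N}$ such that $\Phi_n$ is a continuous modification of $\psi^0_{s_n,\cdot}(x_n)$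 with starting time $s_n$ and $\Phi_n(s_n)=x_n$. Assume - (TF4) the law of $\Phi$ is carried by the set of skeletons, i.e. $\Phi$ is a.s. a skeleton. **The family $\theta$.** Let $\ell:X^{\mathbb N}\to X$ be a measurable map such that $\ell((f_k)_k)$ is a limit point of $(f_k)_k$ for every relatively compact sequence $(f_k)_k$. For $x,y\in M$ let $\mathbb P^{(2)}_{(x,y)}$ be the law on $C([0,\infty):M^2)$ of the Markov process $(X,Y)$ with transition function $\mathsf P^{(2)}$ started at $(x,y)$, let $d_0(f,g)=\delta(e(f),e(g))$ for $f,g\in C([0,\infty):M)$, and for $k\in\mathbb N$ put $$\varepsilon_k(x)=2^{-k}\wedge\inf\Big\{r>0:\sup_{y\in\overline B(x,r)}\mathbb P^{(2)}_{(x,y)}[d_0(X,Y)\ge 2^{-k}]>2^{-k}\Big\}\qquad(\inf\emptyset=\infty).$$ For a skeleton $\varphi$ and $(s,x)\in\mathbb R\times M$ put $n^{s,x}_k=\inf\{n: i(\varphi_n)\le s,\ \rho(\varphi_n(s),x)<\varepsilon_k(x)\}$ and $\Theta(s,x,\varphi)=\ell\big((\varphi_{n^{s,x}_k}[s,\infty))_{k\in\mathbb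 N}\big)$. Finally, on an event $\Omega_0$ of full measure on which $\Phi$ is a skeleton, put $$\theta_{s,t}(\omega,x)=\Theta(s,x,\Phi(\omega))(t),\qquad s\le t,\ x\in M,\ \omega\in\Omega_0.$$ **Theorem.** Such an event $\Omega_0$ exists. For every such $\Omega_0$, the family $\theta$ is a measurable continuous modification of $\psi^0$ on $\Omega_0$ that preserves the skeleton $\Phi$: 1. $(s,t,x,\omega)\mapsto\theta_{s,t}(\omega,x)$ is measurable on $\{s\le t\}\times M\times\Omega_0$ (in particular each $\theta_{s,t}$, $s\le t$, is a random element of $F$); 2. $\theta_{s,s}(\omega,x)=x$, and $t\mapsto\theta_{s,t}(\omega,x)$ is continuous on $[s,\infty)$, for all $(s,x,\omega)\in\mathbb R\times M\times\Omega_0$; 3. for all $s\le t$ and $x\in M$: $\theta_{s,t}(x)=\psi^0_{s,t}(x)$ a.s.; 4. for all $\omega\in\Omega_0$, $n\in\mathbb N$ and $s_n\le s\le t$: $\theta_{s,t}(\omega,\Phi_n(\omega)(s))=\Phi_n(\omega)(t)$. -/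

import Mathlib

open MeasureTheory ProbabilityTheory Filter Topology Set
open scoped NNReal ENNReal ZeroAtInfty

noncomputable section

namespace StochFlow

/-! ### Transition functions -/

/-- A (conservative) Feller transition function on `E`: a semigroup of Markov kernels acting on
`C₀(E)`, strongly continuous at time `0`. -/
structure IsFeller {E : Type*} [TopologicalSpace E] [MeasurableSpace E]
    (P : ℝ≥0 → Kernel E E) : Prop where
  markov : ∀ t, IsMarkovKernel (P t)
  zero : P 0 = Kernel.id
  add : ∀ s t, P (s + t) = P t ∘ₖ P s
  map_zeroAtInfty : ∀ t (f : C₀(E, ℝ)), ∃ g : C₀(E, ℝ), ∀ x, g x = ∫ y, f y ∂(P t x)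
  tendsto_zero : ∀ f : C₀(E, ℝ),
    TendstoUniformly (fun (t : ℝ≥0) x => ∫ y, f y ∂(P t x)) (fun x => f x) (𝓝 0)

/-- Consistency: the marginal of the `n`-point transition function along distinct indices
`ι 0, …, ι (k - 1)` is the `k`-point transition function. -/
def IsConsistent {M : Type*} [MeasurableSpace M]
    (P : (n : ℕ) → ℝ≥0 → Kernel (Fin n → M) (Fin n → M)) : Prop :=
  ∀ (n k : ℕ) (ι : Fin k ↪ Fin n) (t : ℝ≥0) (x : Fin n → M) (B : Set (Fin k → M)),
    MeasurableSet B → P n t x {y | (fun i => y (ι i)) ∈ B} = P k t (fun i => x (ι i)) B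

/-- Coalescence: the two-point motion does not leave the diagonal. -/
def IsCoalescing {M : Type*} [MeasurableSpace M]
    (P : (n : ℕ) → ℝ≥0 → Kernel (Fin n → M) (Fin n → M)) : Prop :=
  ∀ (x : M) (t : ℝ≥0), P 2 t (fun _ => x) {y | y 0 = y 1} = 1

/-- Continuity of one-point trajectories. -/
def HasContinuousTrajectories {M : Type*} [MetricSpace M] [MeasurableSpace M]
    (P : (n : ℕ) → ℝ≥0 → Kernel (Fin n → M) (Fin n → M)) : Prop :=
  ∀ K : Set M, IsCompact K → ∀ r : ℝ, 0 < r →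
    Tendsto (fun t : ℝ≥0 => (⨆ x ∈ K, P 1 t (fun _ => x) {y | r < dist x (y 0)}) / (t : ℝ≥0∞))
      (𝓝[>] 0) (𝓝 0)

/-! ### Stochastic flows of measurable mappings -/

/-- The space of measurable mappings `M → M`; its `σ`-field, inherited from the product
`σ`-field on all mappings, is the cylindrical one. -/
abbrev MeasMap (M : Type*) [MeasurableSpace M] : Type _ := {f : M → M // Measurable f}

/-- `ψ = (ψ s t)_{s ≤ t}` is a stochastic flow of measurable mappings on `M` whose `n`-point
motions have the transition functions `P n`. Values of `ψ s t` for `t < s` play no role. -/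
structure IsStochasticFlow {M : Type*} [MetricSpace M] [MeasurableSpace M]
    (P : (n : ℕ) → ℝ≥0 → Kernel (Fin n → M) (Fin n → M))
    {Ω : Type*} [MeasurableSpace Ω] (μ : Measure Ω) (ψ : ℝ → ℝ → Ω → MeasMap M) : Prop where
  measurable : ∀ s t, s ≤ t → Measurable (ψ s t)
  /-- the `n`-point motions -/
  npoint : ∀ s t, s ≤ t → ∀ (n : ℕ) (x : Fin n → M) (f : C₀(Fin n → M, ℝ)),
    ∫ ω, f (fun i => (ψ s t ω).1 (x i)) ∂μ = ∫ y, f y ∂(P n (t - s).toNNReal x)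
  /-- the weak flow property -/
  flow : ∃ J : ℝ≥0 → MeasMap M × M → M, (∀ t, Measurable (J t)) ∧
    ∀ s t u, s ≤ t → t ≤ u → ∀ x : M,
      (∀ᵐ ω ∂μ, J (t - s).toNNReal (ψ s t ω, x) = (ψ s t ω).1 x) ∧
      (∀ᵐ ω ∂μ, (ψ s u ω).1 x = J (u - t).toNNReal (ψ t u ω, (ψ s t ω).1 x))
  /-- identity at equal times -/
  refl : ∀ s ω x, (ψ s s ω).1 x = x
  /-- independent increments -/
  indep : ∀ (n : ℕ) (t : Fin (n + 1) → ℝ), Monotone t →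
    iIndepFun (fun i : Fin n => ψ (t i.castSucc) (t i.succ)) μ
  /-- time continuity -/
  time_continuity : ∀ (f : C₀(M, ℝ)) (s t : ℝ), s ≤ t →
    Tendsto (fun p : ℝ × ℝ =>
        ⨆ x : M, ∫⁻ ω, ENNReal.ofReal ((f ((ψ p.1 p.2 ω).1 x) - f ((ψ s t ω).1 x)) ^ 2) ∂μ)
      (𝓝[{p : ℝ × ℝ | p.1 ≤ p.2}] (s, t)) (𝓝 0)
  /-- continuity at points of `M` -/
  space_continuity : ∀ (f : C₀(M, ℝ)) (x : M) (s t : ℝ), s ≤ t →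
    Tendsto (fun y : M =>
        ∫⁻ ω, ENNReal.ofReal ((f ((ψ s t ω).1 y) - f ((ψ s t ω).1 x)) ^ 2) ∂μ) (𝓝 x) (𝓝 0)
  /-- decay at infinity -/
  space_decay : ∀ (f : C₀(M, ℝ)) (s t : ℝ), s ≤ t →
    Tendsto (fun y : M => ∫⁻ ω, ENNReal.ofReal (f ((ψ s t ω).1 y) ^ 2) ∂μ) (cocompact M) (𝓝 0)

/-- `ψ'` is a measurable continuous modification of `ψ`: a family of random elements of the space
of measurable mappings, equal to the identity at equal times, with
`ψ' s t x = ψ s t x` a.s. for all `s ≤ t` and `x`, jointly measurable in `(s, t, x, ω)`, and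
with continuous trajectories `ψ' s · x` on `[s, ∞)` for all `(s, x, ω)`. -/
structure IsMeasurableContinuousModification {M : Type*} [MetricSpace M] [MeasurableSpace M]
    {Ω : Type*} [MeasurableSpace Ω] (μ : Measure Ω)
    (ψ' : ℝ → ℝ → Ω → M → M) (ψ : ℝ → ℝ → Ω → MeasMap M) : Prop where
  measurable_map : ∀ s t, s ≤ t → ∀ ω, Measurable (ψ' s t ω)
  measurable_eval : ∀ s t, s ≤ t → ∀ x, Measurable (fun ω => ψ' s t ω x)
  refl : ∀ s ω x, ψ' s s ω x = x
  ae_eq : ∀ s t, s ≤ t → ∀ x, ∀ᵐ ω ∂μ, ψ' s t ω x = (ψ s t ω).1 x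
  measurable : Measurable
    (fun p : {q : ℝ × ℝ // q.1 ≤ q.2} × M × Ω => ψ' p.1.1.1 p.1.1.2 p.2.2 p.2.1)
  continuous : ∀ s ω x, ContinuousOn (fun t => ψ' s t ω x) (Ici s)

/-! ### The space of continuous paths -/

/-- The space `X` of continuous paths `f : [s, ∞) → M`, `s ∈ ℝ`. A path is represented by the pair
`(i(f), e(f))` of its starting time and of its continuous extension to `ℝ` that is constant on
`(-∞, i(f)]`. -/
def PathSpace (M : Type*) [TopologicalSpace M] : Type _ :=
  {p : ℝ × C(ℝ, M) // ∀ t ≤ p.1, p.2 t = p.2 p.1}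

namespace PathSpace

variable {M : Type*} [TopologicalSpace M]

/-- The topology of the distance `|i(f) - i(g)| + δ(e(f), e(g))`, where `δ` metrizes uniform
convergence on compact sets. -/
instance : TopologicalSpace (PathSpace M) :=
  inferInstanceAs (TopologicalSpace {p : ℝ × C(ℝ, M) // ∀ t ≤ p.1, p.2 t = p.2 p.1})

instance : MeasurableSpace (PathSpace M) := borel _

instance : BorelSpace (PathSpace M) := ⟨rfl⟩

/-- The starting time `i(f)`. -/
def start (f : PathSpace M) : ℝ := f.1.1

/-- The continuous extension `e(f)`; for `t ≥ i(f)`, `f.ext t` is the value `f(t)`. -/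
def ext (f : PathSpace M) : C(ℝ, M) := f.1.2

/-- The restriction `f[s, ∞)` of `e(f)` to `[s, ∞)`, as a path that starts at time `s`. -/
def restrict (f : PathSpace M) (s : ℝ) : PathSpace M :=
  ⟨(s, ⟨fun t => f.ext (max s t), by fun_prop⟩), fun t ht => by simp [max_eq_left ht]⟩

end PathSpace

/-- A skeleton: a sequence of paths that coalesce when they meet, whose starting points are dense, and
whose pieces that start in a given compact set form a relatively compact set of paths. -/
structure IsSkeleton {M : Type*} [TopologicalSpace M] (φ : ℕ → PathSpace M) : Prop where
  coalescence : ∀ (s : ℝ) (m n : ℕ), (φ m).start ≤ s → (φ n).start ≤ s →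
    (φ m).ext s = (φ n).ext s → ∀ t, s ≤ t → (φ m).ext t = (φ n).ext t
  dense : DenseRange (fun n => ((φ n).start, (φ n).ext (φ n).start))
  relCompact : ∀ L : Set (ℝ × M), IsCompact L →
    IsCompact (closure
      {g : PathSpace M | ∃ (s : ℝ) (n : ℕ),
        (φ n).start ≤ s ∧ (s, (φ n).ext s) ∈ L ∧ g = (φ n).restrict s})

/-! ### The mapping `Θ` -/

/-- `ℓ` is a measurable mapping that selects a limit point of each relatively compact sequence. -/
structure IsLimitPointSelection {Y : Type*} [TopologicalSpace Y] [MeasurableSpace Y]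
    (ℓ : (ℕ → Y) → Y) : Prop where
  measurable : Measurable ℓ
  mapClusterPt : ∀ f : ℕ → Y, IsCompact (closure (range f)) → MapClusterPt (ℓ f) atTop f

/-- `n_k^{s,x} = inf {n : i(φ_n) ≤ s, ρ(φ_n(s), x) < ε_k(x)}`. -/
def approxIndex {M : Type*} [MetricSpace M] (ε : ℕ → M → ℝ) (s : ℝ) (x : M)
    (φ : ℕ → PathSpace M) (k : ℕ) : ℕ :=
  sInf {n : ℕ | (φ n).start ≤ s ∧ dist ((φ n).ext s) x < ε k x}

/-- `Θ(s, x, φ) = ℓ((φ_k^{s,x})_k)` with `φ_k^{s,x} = φ_{n_k^{s,x}}[s, ∞)`. -/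
def Theta {M : Type*} [MetricSpace M] (ℓ : (ℕ → PathSpace M) → PathSpace M) (ε : ℕ → M → ℝ)
    (s : ℝ) (x : M) (φ : ℕ → PathSpace M) : PathSpace M :=
  ℓ (fun k => (φ (approxIndex ε s x φ k)).restrict s)

/-! ### The functions `ε_k` -/

/-- `δ` is a distance on `C(ℝ, M)` that metrizes uniform convergence on compact sets. -/
structure IsCompatibleDist {M : Type*} [TopologicalSpace M]
    (δ : C(ℝ, M) → C(ℝ, M) → ℝ) : Prop where
  eq_zero_iff : ∀ f g, δ f g = 0 ↔ f = g
  symm : ∀ f g, δ f g = δ g f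
  triangle : ∀ f g h, δ f h ≤ δ f g + δ g h
  nhds_basis : ∀ f, (𝓝 f).HasBasis (fun r : ℝ => 0 < r) (fun r => {g | δ g f < r})

/-- Spaces of continuous paths carry the Borel `σ`-field of the topology of uniform convergence on
compact sets. -/
instance {A B : Type*} [TopologicalSpace A] [TopologicalSpace B] : MeasurableSpace C(A, B) :=
  borel _

/-- `Q` is the law on `C([0, ∞), E)` under which the canonical process is a Markov process with
transition function `P`, started at `x`. -/
structure IsMarkovLaw {E : Type*} [TopologicalSpace E] [MeasurableSpace E]
    (P : ℝ≥0 → Kernel E E) (x : E) (Q : Measure C(ℝ≥0, E)) : Prop where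
  isProbabilityMeasure : IsProbabilityMeasure Q
  initial : ∀ᵐ w ∂Q, w 0 = x
  markov : ∀ (s t : ℝ≥0) (A : Set C(ℝ≥0, E)),
    MeasurableSet[⨆ r : Iic s, MeasurableSpace.comap (fun w : C(ℝ≥0, E) => w r.1) inferInstance] A →
    ∀ B : Set E, MeasurableSet B →
      Q (A ∩ {w | w (s + t) ∈ B}) = ∫⁻ w in A, P t (w s) B ∂Q

open Classical in
/-- The law of the continuous Markov process with transition function `P` started at `x` (there is
at most one such law; the value is `0` if there is none). -/
def pathLaw {E : Type*} [TopologicalSpace E] [MeasurableSpace E]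
    (P : ℝ≥0 → Kernel E E) (x : E) : Measure C(ℝ≥0, E) :=
  if h : ∃ Q, IsMarkovLaw P x Q then h.choose else 0

/-- The `i`-th coordinate of `w ∈ C([0, ∞), M^2)`, extended to `ℝ` by its value at `0`. -/
def coordExt {M : Type*} [TopologicalSpace M] (w : C(ℝ≥0, Fin 2 → M)) (i : Fin 2) : C(ℝ, M) :=
  ⟨fun t => w t.toNNReal i, by fun_prop⟩

/-- `g_k(x, y) = ℙ_{(x,y)}[d₀(X, Y) ≥ 2^{-k}]` for the two-point motion `(X, Y)`. -/
def separationProb {M : Type*} [MetricSpace M] [MeasurableSpace M]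
    (δ : C(ℝ, M) → C(ℝ, M) → ℝ) (P : (n : ℕ) → ℝ≥0 → Kernel (Fin n → M) (Fin n → M))
    (k : ℕ) (x y : M) : ℝ≥0∞ :=
  pathLaw (P 2) ![x, y] {w | (2⁻¹ : ℝ) ^ k ≤ δ (coordExt w 0) (coordExt w 1)}

/-- `ε_k(x) = 2^{-k} ∧ inf {r > 0 : sup_{y ∈ B̄(x, r)} g_k(x, y) > 2^{-k}}` with `inf ∅ = ∞`, written
as the infimum of the set of those `r` together with `2^{-k}`. -/
def epsilon {M : Type*} [MetricSpace M] [MeasurableSpace M]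
    (δ : C(ℝ, M) → C(ℝ, M) → ℝ) (P : (n : ℕ) → ℝ≥0 → Kernel (Fin n → M) (Fin n → M))
    (k : ℕ) (x : M) : ℝ :=
  sInf (insert ((2⁻¹ : ℝ) ^ k)
    {r : ℝ | 0 < r ∧ (2⁻¹ : ℝ≥0∞) ^ k < ⨆ y ∈ Metric.closedBall x r, separationProb δ P k x y})

/-! ### The random sequence `Φ` and the family `θ` -/

/-- `Φ = (Φ_n)` is a random element of `X^ℕ` such that `Φ_n` is a continuous modification of
`ψ_{s_n, ·}(x_n)` with `Φ_n(s_n) = x_n`, where `D n = (s_n, x_n)`. -/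
structure IsSkeletonVersion {M : Type*} [TopologicalSpace M] [MeasurableSpace M]
    {Ω : Type*} [MeasurableSpace Ω] (μ : Measure Ω) (ψ : ℝ → ℝ → Ω → MeasMap M)
    (D : ℕ → ℝ × M) (Φ : Ω → ℕ → PathSpace M) : Prop where
  measurable : Measurable Φ
  start_eq : ∀ ω n, (Φ ω n).start = (D n).1
  initial : ∀ ω n, (Φ ω n).ext (D n).1 = (D n).2
  ae_eq : ∀ n t, (D n).1 ≤ t → ∀ᵐ ω ∂μ, (Φ ω n).ext t = (ψ (D n).1 t ω).1 (D n).2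

/-- `θ_{s,t}(ω, x) = Θ(s, x, Φ(ω))(t)`, with `Θ` built from the functions `ε_k`. -/
def theta {M : Type*} [MetricSpace M] [MeasurableSpace M]
    (δ : C(ℝ, M) → C(ℝ, M) → ℝ) (P : (n : ℕ) → ℝ≥0 → Kernel (Fin n → M) (Fin n → M))
    (ℓ : (ℕ → PathSpace M) → PathSpace M) {Ω : Type*} (Φ : Ω → ℕ → PathSpace M)
    (s t : ℝ) (ω : Ω) (x : M) : M :=
  (Theta ℓ (epsilon δ P) s x (Φ ω)).ext t

/-- The family `ϑ = (ϑ s t)_{s ≤ t}` of mappings preserves the sequence of paths `φ`. -/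
structure PreservesSkeleton {M : Type*} [TopologicalSpace M]
    (ϑ : ℝ → ℝ → M → M) (φ : ℕ → PathSpace M) : Prop where
  refl : ∀ s x, ϑ s s x = x
  map_path : ∀ (n : ℕ) (s t : ℝ), (φ n).start ≤ s → s ≤ t → ϑ s t ((φ n).ext s) = (φ n).ext t

end StochFlow

end

open StochFlow

/-!
The limits that define `θ` exist and agree with the flow because the skeleton property supplies all
the compactness that is needed.

*Continuous versions.* Let `(s_j, x_j) → (s, x)`. The flow is continuous in mean square, jointly in
time and space, so along a subsequence `ψ_{s_j,t}(x_j) → ψ_{s,t}(x)` almost surely for all `t` in a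
countable dense set of times. If the trajectories from `(s_j, x_j)` have continuous versions whose
paths are limits of pieces of `Φ`, then these versions form a relatively compact sequence by the
skeleton property, and hence converge almost surely in the space of paths, to a version of the
trajectory from `(s, x)` (`exists_subseq_tendsto_isPathVersion`). Starting from the paths `Φ_n`, this
gives versions of all trajectories; applied to these versions once more, it shows that they depend
continuously on the starting point, up to passing to subsequences.

*The functions `ε_k`.* The pair of the versions from `(s, x)` and `(s, y)` is a Markov process with
transition function `P 2` (`isMarkovLaw_pairPath`). Since a Markov law is unique, the function
`(x, y) ↦ ℙ_{(x,y)}[d₀(X, Y) ≥ 2^{-k}]` can be computed with these versions. It is upper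
semicontinuous and vanishes on the diagonal, so `ε_k` is measurable and positive.

*Agreement with the flow.* The index `n_k` and the point `U = Φ_{n_k}(s)` belong to the past at time
`s`, and afterwards `Φ_{n_k}` is driven by the maps `ψ_{s,t}`, which are independent of the past
(`IsStochasticFlow.indep_past_future`). With `U` frozen, the probability that `Φ_{n_k}[s, ∞)` is
separated by `2^{-k}` from the trajectory of `x` is at most `2^{-k}` by the choice of `ε_k`
(`IsFlowWithSkeleton.measure_separated_le`). By the Borel–Cantelli lemma the approximating paths
converge almost surely to the trajectory of `x`, so `θ_{s,t}(x) = ψ_{s,t}(x)` almost surely.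

*Preservation of the skeleton.* For `x = Φ_n(s)` the minimal index `n_k` never exceeds `n`; as
`Φ_{n_k}(s) → x`, the paths `Φ_{n_k}` and `Φ_n` meet at time `s` for large `k`, and coalesce
(`IsSkeleton.preservesSkeleton`).
-/

namespace StochFlow

/-! ### Cluster points of convergent families -/

theorem eq_of_mapClusterPt_of_tendsto {ι X : Type*} [TopologicalSpace X] [T2Space X] {l : Filter ι}
    {u : ι → X} {a b : X} (ha : MapClusterPt a l u) (hb : Tendsto u l (𝓝 b)) : a = b := by
  by_contra hne
  exact ha.ne (disjoint_iff.1 ((disjoint_nhds_nhds.2 hne).mono_right hb))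

/-! ### The space of paths -/

namespace PathSpace

variable {M : Type*} [TopologicalSpace M]

theorem continuous_start : Continuous (start : PathSpace M → ℝ) :=
  continuous_fst.comp continuous_subtype_val

theorem continuous_ext : Continuous (ext : PathSpace M → C(ℝ, M)) :=
  continuous_snd.comp continuous_subtype_val

theorem continuous_ext_apply : Continuous (fun p : PathSpace M × ℝ => p.1.ext p.2) :=
  continuous_eval.comp ((continuous_ext.comp continuous_fst).prodMk continuous_snd)

theorem continuous_ext_apply_const (t : ℝ) : Continuous (fun f : PathSpace M => f.ext t) :=
  continuous_ext_apply.comp (continuous_id.prodMk continuous_const)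

theorem continuous_startPoint :
    Continuous (fun f : PathSpace M => (f.start, f.ext f.start)) :=
  continuous_start.prodMk (continuous_ext_apply.comp (continuous_id.prodMk continuous_start))

theorem ext_of_le_start (f : PathSpace M) {t : ℝ} (ht : t ≤ f.start) : f.ext t = f.ext f.start :=
  f.2 t ht

theorem restrict_ext_apply (f : PathSpace M) (s t : ℝ) : (f.restrict s).ext t = f.ext (max s t) :=
  rfl

theorem eq_of_ext_eqOn {f g : PathSpace M} (hs : f.start = g.start)
    (h : ∀ t, f.start ≤ t → f.ext t = g.ext t) : f = g := by
  refine Subtype.ext (Prod.ext hs (ContinuousMap.ext fun t => ?_))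
  change f.ext t = g.ext t
  rcases le_total f.start t with ht | ht
  · exact h t ht
  · rw [f.ext_of_le_start ht, g.ext_of_le_start (hs ▸ ht), h _ le_rfl, hs]

theorem restrict_self (f : PathSpace M) : f.restrict f.start = f :=
  eq_of_ext_eqOn rfl fun t ht => by
    rw [restrict_ext_apply, max_eq_right (show f.start ≤ t from ht)]

theorem continuous_restrict : Continuous (fun p : PathSpace M × ℝ => p.1.restrict p.2) := by
  refine Continuous.subtype_mk (continuous_snd.prodMk ?_) _
  refine ContinuousMap.continuous_of_continuous_uncurry _ ?_
  exact continuous_ext_apply.comp ((continuous_fst.comp continuous_fst).prodMk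
    ((continuous_snd.comp continuous_fst).max continuous_snd))

instance [T2Space M] : T2Space (PathSpace M) :=
  inferInstanceAs (T2Space {p : ℝ × C(ℝ, M) // ∀ t ≤ p.1, p.2 t = p.2 p.1})

instance [SecondCountableTopology M] : SecondCountableTopology (PathSpace M) :=
  TopologicalSpace.Subtype.secondCountableTopology
    {p : ℝ × C(ℝ, M) | ∀ t ≤ p.1, p.2 t = p.2 p.1}

instance [TopologicalSpace.MetrizableSpace M] : TopologicalSpace.MetrizableSpace (PathSpace M) :=
  (Topology.IsEmbedding.subtypeVal
    (p := fun p : ℝ × C(ℝ, M) => ∀ t ≤ p.1, p.2 t = p.2 p.1)).metrizableSpace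

theorem measurable_ext_apply_const [MeasurableSpace M] [BorelSpace M] (t : ℝ) :
    Measurable (fun f : PathSpace M => f.ext t) :=
  (continuous_ext_apply_const t).measurable

end PathSpace

/-- The restrictions `φ_n[s, ∞)`, `s ≥ i(φ_n)`, of the paths of `φ` whose starting point
`(s, φ_n(s))` lies in `L`. -/
def pieces {M : Type*} [TopologicalSpace M] (φ : ℕ → PathSpace M) (L : Set (ℝ × M)) :
    Set (PathSpace M) :=
  {g | ∃ (s : ℝ) (n : ℕ), (φ n).start ≤ s ∧ (s, (φ n).ext s) ∈ L ∧ g = (φ n).restrict s}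

theorem IsSkeleton.isCompact_closure_pieces {M : Type*} [TopologicalSpace M]
    {φ : ℕ → PathSpace M} (hφ : IsSkeleton φ) {L : Set (ℝ × M)} (hL : IsCompact L) :
    IsCompact (closure (pieces φ L)) :=
  hφ.relCompact L hL

theorem mem_pieces_self {M : Type*} [TopologicalSpace M] {φ : ℕ → PathSpace M} {L : Set (ℝ × M)}
    {n : ℕ} (h : ((φ n).start, (φ n).ext (φ n).start) ∈ L) : φ n ∈ pieces φ L :=
  ⟨_, n, le_rfl, h, (PathSpace.restrict_self _).symm⟩

/-! ### Approximation of a point by the paths of a skeleton -/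

section Skeleton

variable {M : Type*} [MetricSpace M] {φ : ℕ → PathSpace M}

/-- Every point of `M` is approximated at every time `s` by paths of the skeleton. Paths that start
shortly before `s`, close to `x`, form a relatively compact set, so they do not have enough time
to leave a neighbourhood of `x`. -/
theorem IsSkeleton.exists_dist_lt (hφ : IsSkeleton φ) (s : ℝ) (x : M) {r : ℝ} (hr : 0 < r) :
    ∃ n, (φ n).start ≤ s ∧ dist ((φ n).ext s) x < r := by
  have hdense : ∀ j : ℕ, ∃ n, (φ n).start ∈ Ioo (s - 1 / ((j : ℝ) + 1)) s ∧
      dist ((φ n).ext (φ n).start) x < 1 / ((j : ℝ) + 1) := by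
    intro j
    have hj : (0 : ℝ) < 1 / ((j : ℝ) + 1) := Nat.one_div_pos_of_nat
    obtain ⟨n, hn⟩ := hφ.dense.exists_mem_open
      (isOpen_Ioo.prod (Metric.isOpen_ball (x := x) (ε := 1 / ((j : ℝ) + 1))))
      (s := Ioo (s - 1 / ((j : ℝ) + 1)) s ×ˢ Metric.ball x (1 / ((j : ℝ) + 1)))
      ⟨(s - 1 / ((j : ℝ) + 1) / 2, x), ⟨⟨by linarith, by linarith⟩, Metric.mem_ball_self hj⟩⟩
    exact ⟨n, hn.1, hn.2⟩
  choose n hn using hdense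
  have hlim : Tendsto (fun j => ((φ (n j)).start, (φ (n j)).ext (φ (n j)).start)) atTop
      (𝓝 (s, x)) := by
    refine Tendsto.prodMk_nhds ?_ ?_
    · refine tendsto_of_tendsto_of_tendsto_of_le_of_le ?_ tendsto_const_nhds
        (fun j => (hn j).1.1.le) (fun j => (hn j).1.2.le)
      simpa using (tendsto_const_nhds (x := s)).sub tendsto_one_div_add_atTop_nhds_zero_nat
    · exact tendsto_iff_dist_tendsto_zero.2 (squeeze_zero (fun _ => dist_nonneg)
        (fun j => (hn j).2.le) tendsto_one_div_add_atTop_nhds_zero_nat)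
  obtain ⟨g, -, hg⟩ := (hφ.isCompact_closure_pieces hlim.isCompact_insert_range).exists_mapClusterPt
    (f := atTop) (u := fun j => φ (n j)) (by
      refine le_principal_iff.2 (mem_map.2 (Eventually.of_forall fun j => subset_closure ?_))
      exact mem_pieces_self (Or.inr ⟨j, rfl⟩))
  have hgs : (g.start, g.ext g.start) = (s, x) := eq_of_mapClusterPt_of_tendsto
    (hg.continuousAt_comp (f := fun f : PathSpace M => (f.start, f.ext f.start))
      PathSpace.continuous_startPoint.continuousAt) hlim
  obtain ⟨h1, h2⟩ := Prod.ext_iff.1 hgs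
  simp only at h1 h2
  have hgx := hg.continuousAt_comp (PathSpace.continuous_ext_apply_const s).continuousAt
  rw [← h1, h2] at hgx
  obtain ⟨j, hj⟩ := (hgx.frequently (Metric.ball_mem_nhds x hr)).exists
  exact ⟨n j, (hn j).1.2.le, by rw [← h1]; exact hj⟩

variable {ε : ℕ → M → ℝ} {s : ℝ} {x : M}

theorem IsSkeleton.approxIndex_spec (hφ : IsSkeleton φ) {k : ℕ} (hε : 0 < ε k x) :
    (φ (approxIndex ε s x φ k)).start ≤ s ∧
      dist ((φ (approxIndex ε s x φ k)).ext s) x < ε k x :=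
  Nat.sInf_mem (s := {n : ℕ | (φ n).start ≤ s ∧ dist ((φ n).ext s) x < ε k x})
    (hφ.exists_dist_lt s x hε)

theorem IsSkeleton.tendsto_approx (hφ : IsSkeleton φ) (hε : ∀ k, 0 < ε k x)
    (hε' : ∀ k, ε k x ≤ 2⁻¹ ^ k) :
    Tendsto (fun k => (φ (approxIndex ε s x φ k)).ext s) atTop (𝓝 x) := by
  refine tendsto_iff_dist_tendsto_zero.2 (squeeze_zero (fun _ => dist_nonneg) (fun k =>
    (hφ.approxIndex_spec (hε k)).2.le.trans (hε' k)) ?_)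
  exact tendsto_pow_atTop_nhds_zero_of_lt_one (by norm_num) (by norm_num)

theorem IsSkeleton.mapClusterPt_Theta (hφ : IsSkeleton φ) (hε : ∀ k, 0 < ε k x)
    (hε' : ∀ k, ε k x ≤ 2⁻¹ ^ k) {ℓ : (ℕ → PathSpace M) → PathSpace M}
    (hℓ : IsLimitPointSelection ℓ) :
    MapClusterPt (Theta ℓ ε s x φ) atTop
      (fun k => (φ (approxIndex ε s x φ k)).restrict s) := by
  refine hℓ.mapClusterPt _ ?_
  have hc : IsCompact (insert (s, x) (range fun k => (s, (φ (approxIndex ε s x φ k)).ext s))) :=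
    (tendsto_const_nhds.prodMk_nhds (hφ.tendsto_approx hε hε')).isCompact_insert_range
  refine (hφ.isCompact_closure_pieces hc).of_isClosed_subset isClosed_closure (closure_mono ?_)
  rintro _ ⟨k, rfl⟩
  exact ⟨s, _, (hφ.approxIndex_spec (hε k)).1, Or.inr ⟨k, rfl⟩, rfl⟩

/-- If the approximating paths converge at time `t`, their limit is the value of `Θ` at time `t`. -/
theorem IsSkeleton.Theta_ext_eq (hφ : IsSkeleton φ) (hε : ∀ k, 0 < ε k x)
    (hε' : ∀ k, ε k x ≤ 2⁻¹ ^ k) {ℓ : (ℕ → PathSpace M) → PathSpace M}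
    (hℓ : IsLimitPointSelection ℓ) {t : ℝ} (ht : s ≤ t) {z : M}
    (hz : Tendsto (fun k => (φ (approxIndex ε s x φ k)).ext t) atTop (𝓝 z)) :
    (Theta ℓ ε s x φ).ext t = z := by
  have h1 := (hφ.mapClusterPt_Theta (s := s) hε hε' hℓ).continuousAt_comp
    (PathSpace.continuous_ext_apply_const t).continuousAt
  have h2 : ((fun f : PathSpace M => f.ext t) ∘
      fun k => (φ (approxIndex ε s x φ k)).restrict s) =
      fun k => (φ (approxIndex ε s x φ k)).ext t := by
    funext k
    simp [PathSpace.restrict_ext_apply, max_eq_right ht]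
  rw [h2] at h1
  exact eq_of_mapClusterPt_of_tendsto h1 hz

/-- On a point `φ_n(s)` of the skeleton the index `n_k` never exceeds `n`. Hence the approximating
paths meet `φ_n` at time `s` as soon as `k` is large, and then coincide with `φ_n`. -/
theorem IsSkeleton.preservesSkeleton (hφ : IsSkeleton φ) (hε : ∀ k x, 0 < ε k x)
    (hε' : ∀ k x, ε k x ≤ 2⁻¹ ^ k) {ℓ : (ℕ → PathSpace M) → PathSpace M}
    (hℓ : IsLimitPointSelection ℓ) :
    PreservesSkeleton (fun s t x => (Theta ℓ ε s x φ).ext t) φ where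
  refl s x := hφ.Theta_ext_eq (hε · x) (hε' · x) hℓ le_rfl
    (hφ.tendsto_approx (hε · x) (hε' · x))
  map_path n s t hs hst := by
    refine hφ.Theta_ext_eq (hε · _) (hε' · _) hℓ hst (tendsto_const_nhds.congr' ?_)
    have hle : ∀ k, approxIndex ε s ((φ n).ext s) φ k ≤ n := fun k =>
      Nat.sInf_le (show (φ n).start ≤ s ∧ dist ((φ n).ext s) ((φ n).ext s) < _ from
        ⟨hs, by simpa using hε k _⟩)
    have hlim := hφ.tendsto_approx (s := s) (hε · ((φ n).ext s)) (hε' · _)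
    have hev : ∀ᶠ k in atTop, ∀ m ∈ Iic n, (φ m).ext s ≠ (φ n).ext s →
        (φ (approxIndex ε s ((φ n).ext s) φ k)).ext s ≠ (φ m).ext s := by
      rw [(finite_Iic n).eventually_all]
      intro m _
      by_cases hm : (φ m).ext s = (φ n).ext s
      · exact Eventually.of_forall fun k h => absurd hm h
      · filter_upwards [hlim.eventually_ne (Ne.symm hm)] with k hk _ using hk
    filter_upwards [hev] with k hk
    refine (hφ.coalescence s _ _ (hφ.approxIndex_spec (hε k _)).1 hs ?_ t hst).symm
    by_contra hne
    exact hk _ (hle k) hne rfl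

end Skeleton

/-! ### Functions vanishing at infinity -/

section Functions

variable {M : Type*} [MetricSpace M]

/-- The function `max (r - ρ(·, p), 0)`, replaced by `0` if the closed ball of radius `r` around `p`
is not compact. -/
noncomputable def bump (p : M) (r : ℝ) : C₀(M, ℝ) := by
  classical
  exact if h : IsCompact (Metric.closedBall p r) then
    { toFun := fun y => max (r - dist y p) 0
      continuous_toFun := by fun_prop
      zero_at_infty' := by
        refine tendsto_const_nhds.congr' ?_
        filter_upwards [h.compl_mem_cocompact] with y hy
        have : r < dist y p := by simpa using hy
        exact (max_eq_right (by linarith)).symm }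
  else 0

theorem bump_apply {p : M} {r : ℝ} (h : IsCompact (Metric.closedBall p r)) (y : M) :
    bump p r y = max (r - dist y p) 0 := by
  simp only [bump, dif_pos h]
  rfl

variable (M) in
/-- A sequence of functions in `C₀(M)` that determines the topology of `M`. -/
noncomputable def testFun [TopologicalSpace.SeparableSpace M] [Nonempty M] (m : ℕ) : C₀(M, ℝ) :=
  bump (TopologicalSpace.denseSeq M m.unpair.1) (1 / ((m.unpair.2 : ℝ) + 1))

theorem tendsto_of_tendsto_testFun [LocallyCompactSpace M] [TopologicalSpace.SeparableSpace M]
    [Nonempty M] {ι : Type*} {l : Filter ι} {u : ι → M} {x : M}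
    (h : ∀ m, Tendsto (fun i => testFun M m (u i)) l (𝓝 (testFun M m x))) :
    Tendsto u l (𝓝 x) := by
  obtain ⟨r, hr, hrc⟩ : ∃ r > 0, IsCompact (Metric.closedBall x r) := by
    obtain ⟨K, hK, hKx⟩ := exists_compact_mem_nhds x
    obtain ⟨r, hr, hrK⟩ := Metric.nhds_basis_closedBall.mem_iff.1 hKx
    exact ⟨r, hr, hK.of_isClosed_subset Metric.isClosed_closedBall hrK⟩
  refine Metric.nhds_basis_ball.tendsto_right_iff.2 fun η hη => ?_
  obtain ⟨k, hk⟩ := exists_nat_one_div_lt (half_pos (lt_min hr hη))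
  have hk0 : (0 : ℝ) < 1 / ((k : ℝ) + 1) := Nat.one_div_pos_of_nat
  obtain ⟨i, hi⟩ := (TopologicalSpace.denseRange_denseSeq M).exists_dist_lt x hk0
  have hmin1 := min_le_left r η
  have hmin2 := min_le_right r η
  have hc : IsCompact (Metric.closedBall (TopologicalSpace.denseSeq M i) (1 / ((k : ℝ) + 1))) := by
    refine hrc.of_isClosed_subset Metric.isClosed_closedBall
      (Metric.closedBall_subset_closedBall' ?_)
    rw [dist_comm]; linarith
  have hm := h (Nat.pair i k)
  simp only [testFun, Nat.unpair_pair, bump_apply hc] at hm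
  have hpos : 0 < max (1 / ((k : ℝ) + 1) - dist x (TopologicalSpace.denseSeq M i)) 0 :=
    lt_max_of_lt_left (by linarith)
  filter_upwards [hm.eventually_const_lt hpos] with j hj
  have hj' : dist (u j) (TopologicalSpace.denseSeq M i) < 1 / ((k : ℝ) + 1) := by
    by_contra hcon
    rw [max_eq_right (by linarith)] at hj
    exact lt_irrefl _ hj
  rw [Metric.mem_ball]
  have := dist_triangle_right (u j) x (TopologicalSpace.denseSeq M i)
  linarith

end Functions

/-- A finite measure on a locally compact separable metrizable space is determined by the integrals
of the functions that vanish at infinity. -/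
theorem measure_ext_of_integral_zeroAtInfty {E : Type*} [TopologicalSpace E] [T2Space E]
    [LocallyCompactSpace E] [SecondCountableTopology E] [MeasurableSpace E] [BorelSpace E]
    {μ ν : Measure E} [IsFiniteMeasure μ] [IsFiniteMeasure ν]
    (h : ∀ f : C₀(E, ℝ), ∫ x, f x ∂μ = ∫ x, f x ∂ν) : μ = ν :=
  Measure.ext_of_integral_eq_on_compactlySupported fun f =>
    h ⟨f.toContinuousMap, f.hasCompactSupport.is_zero_at_infty⟩

/-! ### The Borel sets of a space of continuous functions -/

section Borel

variable {E : Type*} [TopologicalSpace E] [MeasurableSpace E] [BorelSpace E]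

instance {A B : Type*} [TopologicalSpace A] [TopologicalSpace B] : BorelSpace C(A, B) := ⟨rfl⟩

theorem measurable_eval_const {A : Type*} [TopologicalSpace A] (t : A) :
    Measurable (fun w : C(A, E) => w t) :=
  (continuous_eval_const t).measurable

/-- The Borel `σ`-field of `C([0, ∞), E)` is generated by the values on a countable dense set of
times. -/
theorem borel_le_comap_denseSeq [TopologicalSpace.PseudoMetrizableSpace E]
    [SecondCountableTopology E] :
    (inferInstance : MeasurableSpace C(ℝ≥0, E)) ≤
      MeasurableSpace.comap (fun w (l : ℕ) => w (TopologicalSpace.denseSeq ℝ≥0 l))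
        inferInstance := by
  let _ := TopologicalSpace.pseudoMetrizableSpacePseudoMetric E
  set m : MeasurableSpace C(ℝ≥0, E) := MeasurableSpace.comap
    (fun w (l : ℕ) => w (TopologicalSpace.denseSeq ℝ≥0 l)) inferInstance with hm
  have hseq (l : ℕ) : Measurable[m] fun w : C(ℝ≥0, E) => w (TopologicalSpace.denseSeq ℝ≥0 l) :=
    fun S hS => ⟨(fun y : ℕ → E => y l) ⁻¹' S, measurable_pi_apply l hS, rfl⟩
  have heval (t : ℝ≥0) : Measurable[m] fun w : C(ℝ≥0, E) => w t := by
    obtain ⟨u, hu, hut⟩ := mem_closure_iff_seq_limit.1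
      ((TopologicalSpace.denseRange_denseSeq ℝ≥0).closure_eq.symm ▸ mem_univ t)
    choose l hl using hu
    refine @measurable_of_tendsto_metrizable _ _ m _ _ _ _ (fun j w => w (u j)) _
      (fun j => by simpa only [hl] using hseq (l j)) ?_
    exact tendsto_pi_nhds.2 fun w => (w.continuous.tendsto t).comp hut
  change borel _ ≤ _
  rw [borel_eq_generateFrom_of_subbasis ContinuousMap.compactOpen_eq]
  refine MeasurableSpace.generateFrom_le ?_
  rintro _ ⟨K, hK, U, hU, rfl⟩
  obtain ⟨c, hc, hcd⟩ := TopologicalSpace.exists_countable_dense K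
  -- By compactness `w` maps `K` into the open set `U` exactly if it maps a countable dense subset
  -- of `K` into one of the closed sets of points at distance at least `1 / m` from `Uᶜ`.
  have hset : {w : C(ℝ≥0, E) | MapsTo w K U} = ⋃ m : ℕ, ⋂ t ∈ c,
      (fun w : C(ℝ≥0, E) => w (t : ℝ≥0)) ⁻¹' {y | (m : ℝ≥0∞)⁻¹ ≤ Metric.infEDist y Uᶜ} := by
    ext w
    simp only [mem_ofPred_eq, mem_iUnion, mem_iInter, mem_preimage]
    constructor
    · intro hw
      rcases K.eq_empty_or_nonempty with rfl | hne
      · exact ⟨0, fun t => absurd t.2 (notMem_empty _)⟩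
      · obtain ⟨t₀, ht₀, hmin⟩ := hK.exists_isMinOn hne
          (f := fun t => Metric.infEDist (w t) Uᶜ)
          (Metric.continuous_infEDist.comp w.continuous).continuousOn
        have hpos : 0 < Metric.infEDist (w t₀) Uᶜ := by
          rw [Metric.infEDist_pos_iff_notMem_closure, hU.isClosed_compl.closure_eq]
          exact fun h => h (hw ht₀)
        obtain ⟨m, hm⟩ := ENNReal.exists_inv_nat_lt hpos.ne'
        exact ⟨m, fun t _ => hm.le.trans (hmin t.2)⟩
    · rintro ⟨m, hmem⟩ t ht
      have hcl : IsClosed {t : K | (m : ℝ≥0∞)⁻¹ ≤ Metric.infEDist (w t) Uᶜ} :=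
        isClosed_le continuous_const
          (Metric.continuous_infEDist.comp (w.continuous.comp continuous_subtype_val))
      have h := (hcl.closure_subset_iff (s := c)).2 (fun t ht => hmem t ht) (hcd ⟨t, ht⟩)
      by_contra hcon
      have h0 : Metric.infEDist (w t) Uᶜ = 0 := Metric.infEDist_zero_of_mem hcon
      simp only [mem_ofPred_eq, h0] at h
      simp at h
  change MeasurableSet[m] {w : C(ℝ≥0, E) | MapsTo w K U}
  rw [hset]
  refine @MeasurableSet.iUnion _ _ m _ _ fun m' => @MeasurableSet.biInter _ _ m _ _ hc fun t _ =>
    heval t ?_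
  exact (isClosed_le continuous_const Metric.continuous_infEDist).measurableSet

theorem measurable_of_eval [TopologicalSpace.PseudoMetrizableSpace E]
    [SecondCountableTopology E] {α : Type*} [MeasurableSpace α] {W : α → C(ℝ≥0, E)}
    (h : ∀ t, Measurable fun a => W a t) : Measurable W := by
  refine Measurable.mono (mb := MeasurableSpace.comap
    (fun w (l : ℕ) => w (TopologicalSpace.denseSeq ℝ≥0 l)) inferInstance) ?_ le_rfl
    borel_le_comap_denseSeq
  exact measurable_comap_iff.2 (measurable_pi_lambda _ fun l => h _)

theorem exists_preimage_denseSeq [TopologicalSpace.PseudoMetrizableSpace E]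
    [SecondCountableTopology E] {S : Set C(ℝ≥0, E)} (hS : MeasurableSet S) :
    ∃ B : Set (ℕ → E), MeasurableSet B ∧
      (fun w l => w (TopologicalSpace.denseSeq ℝ≥0 l)) ⁻¹' B = S :=
  borel_le_comap_denseSeq _ hS

end Borel

/-! ### Uniqueness of Markov laws -/

section Uniqueness

variable {E : Type*} [TopologicalSpace E] [MeasurableSpace E] [BorelSpace E]
  {P : ℝ≥0 → Kernel E E} {x : E} {Q Q' : Measure C(ℝ≥0, E)}

omit [BorelSpace E] in
theorem measurableSet_cylinder_of_le {T : Finset ℝ≥0} {B : ℝ≥0 → Set E}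
    (hB : ∀ t, MeasurableSet (B t)) {a : ℝ≥0} (hT : ∀ t ∈ T, t ≤ a) :
    MeasurableSet[⨆ r : Iic a, MeasurableSpace.comap (fun w : C(ℝ≥0, E) => w r.1) inferInstance]
      {w | ∀ t ∈ T, w t ∈ B t} := by
  rw [show {w : C(ℝ≥0, E) | ∀ t ∈ T, w t ∈ B t} = ⋂ t ∈ T, (fun w => w t) ⁻¹' B t by
    ext; simp]
  refine Finset.measurableSet_biInter _ fun t ht => ?_
  exact le_iSup (fun r : Iic a => MeasurableSpace.comap (fun w : C(ℝ≥0, E) => w r.1)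
    (inferInstance : MeasurableSpace E)) ⟨t, hT t ht⟩ _ ⟨B t, hB t, rfl⟩

/-- The Markov property expresses the law at time `r` of the process restricted to a cylinder event
before time `a` through the restricted law at time `a`. -/
theorem IsMarkovLaw.map_restrict_apply (hQ : IsMarkovLaw P x Q) {T : Finset ℝ≥0}
    {B : ℝ≥0 → Set E} (hB : ∀ t, MeasurableSet (B t)) {a r : ℝ≥0} (hT : ∀ t ∈ T, t ≤ a)
    (har : a ≤ r) {S : Set E} (hS : MeasurableSet S) :
    (Q.restrict {w | ∀ t ∈ T, w t ∈ B t}).map (fun w => w r) S =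
      ∫⁻ z, P (r - a) z S ∂((Q.restrict {w | ∀ t ∈ T, w t ∈ B t}).map (fun w => w a)) := by
  rw [Measure.map_apply (measurable_eval_const r) hS,
    Measure.restrict_apply (measurable_eval_const r hS),
    lintegral_map (Kernel.measurable_coe _ hS) (measurable_eval_const a),
    ← hQ.markov a (r - a) _ (measurableSet_cylinder_of_le hB hT) S hS, add_tsub_cancel_of_le har,
    inter_comm]
  rfl

theorem IsMarkovLaw.map_restrict_eq (hQ : IsMarkovLaw P x Q) (hQ' : IsMarkovLaw P x Q')
    {B : ℝ≥0 → Set E} (hB : ∀ t, MeasurableSet (B t)) (T : Finset ℝ≥0) :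
    ∀ r, (∀ t ∈ T, t ≤ r) →
      (Q.restrict {w | ∀ t ∈ T, w t ∈ B t}).map (fun w => w r) =
        (Q'.restrict {w | ∀ t ∈ T, w t ∈ B t}).map (fun w => w r) := by
  have h0 : Q.map (fun w => w 0) = Q'.map (fun w => w 0) := by
    have := hQ.isProbabilityMeasure
    have := hQ'.isProbabilityMeasure
    rw [Measure.map_congr (g := fun _ => x) hQ.initial,
      Measure.map_congr (g := fun _ => x) hQ'.initial, Measure.map_const, Measure.map_const,
      measure_univ, measure_univ]
  induction T using Finset.induction_on_max with
  | empty =>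
    intro r _
    ext S hS
    rw [hQ.map_restrict_apply hB (T := ∅) (a := 0) (by simp) zero_le hS,
      hQ'.map_restrict_apply hB (T := ∅) (a := 0) (by simp) zero_le hS]
    simp [h0]
  | insert a T haT ih =>
    intro r hr
    have ha : ∀ t ∈ insert a T, t ≤ a := fun t ht => by
      rcases Finset.mem_insert.1 ht with rfl | ht
      exacts [le_rfl, (haT t ht).le]
    have hset : {w : C(ℝ≥0, E) | ∀ t ∈ insert a T, w t ∈ B t} =
        (fun w => w a) ⁻¹' B a ∩ {w | ∀ t ∈ T, w t ∈ B t} := by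
      ext w; simp
    have hmap (Q : Measure C(ℝ≥0, E)) :
        (Q.restrict {w | ∀ t ∈ insert a T, w t ∈ B t}).map (fun w => w a) =
          ((Q.restrict {w | ∀ t ∈ T, w t ∈ B t}).map (fun w => w a)).restrict (B a) := by
      rw [Measure.restrict_map (measurable_eval_const a) (hB a),
        Measure.restrict_restrict (measurable_eval_const a (hB a)), hset]
    ext S hS
    have har : a ≤ r := hr a (Finset.mem_insert_self a T)
    rw [hQ.map_restrict_apply hB ha har hS, hQ'.map_restrict_apply hB ha har hS, hmap, hmap,
      ih a fun t ht => (haT t ht).le]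

/-- There is at most one law on `C([0, ∞), E)` of the Markov process with transition function `P`
started at `x`. -/
theorem IsMarkovLaw.unique [TopologicalSpace.PseudoMetrizableSpace E]
    [SecondCountableTopology E] (hQ : IsMarkovLaw P x Q) (hQ' : IsMarkovLaw P x Q') : Q = Q' := by
  have := hQ.isProbabilityMeasure
  have := hQ'.isProbabilityMeasure
  let m (t : ℝ≥0) : MeasurableSpace C(ℝ≥0, E) := MeasurableSpace.comap (fun w => w t) inferInstance
  refine ext_of_generate_finite
    (piiUnionInter (fun t => {s | MeasurableSet[m t] s}) univ) ?_
    (isPiSystem_piiUnionInter _ (fun t => @MeasurableSpace.isPiSystem_measurableSet _ (m t)) _)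
    ?_ (by simp)
  · rw [generateFrom_piiUnionInter_measurableSet m]
    refine le_antisymm (borel_le_comap_denseSeq.trans ?_) (iSup₂_le fun t _ =>
      (measurable_eval_const t).comap_le)
    change MeasurableSpace.comap _ MeasurableSpace.pi ≤ _
    simp only [MeasurableSpace.pi, MeasurableSpace.comap_iSup, MeasurableSpace.comap_comp]
    exact iSup_le fun l => le_iSup₂_of_le (f := fun t _ => m t)
      (TopologicalSpace.denseSeq ℝ≥0 l) (mem_univ _) le_rfl
  · rintro _ ⟨T, -, f, hf, rfl⟩
    choose! B hB hBf using hf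
    obtain ⟨B', hB', hBB'⟩ : ∃ B' : ℝ≥0 → Set E, (∀ t, MeasurableSet (B' t)) ∧
        ∀ t ∈ T, B' t = B t := by
      classical
      refine ⟨fun t => if t ∈ T then B t else ∅, fun t => ?_, fun t ht => if_pos ht⟩
      change MeasurableSet (if t ∈ T then B t else ∅)
      split_ifs with ht
      exacts [hB t ht, MeasurableSet.empty]
    have hset : ⋂ t ∈ T, f t = {w : C(ℝ≥0, E) | ∀ t ∈ T, w t ∈ B' t} := by
      ext w
      simp only [mem_iInter, mem_ofPred_eq]
      refine forall₂_congr fun t ht => ?_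
      rw [← hBf t ht, hBB' t ht, mem_preimage]
    have h := congrArg (fun ν => ν univ)
      (hQ.map_restrict_eq hQ' hB' T (T.sup id) fun t ht => Finset.le_sup (f := id) ht)
    rw [hset]
    simpa [Measure.map_apply (measurable_eval_const _) MeasurableSet.univ] using h

theorem pathLaw_eq [TopologicalSpace.PseudoMetrizableSpace E]
    [SecondCountableTopology E] (hQ : IsMarkovLaw P x Q) : pathLaw P x = Q := by
  have h : ∃ Q, IsMarkovLaw P x Q := ⟨Q, hQ⟩
  rw [pathLaw, dif_pos h]
  exact h.choose_spec.unique hQ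

end Uniqueness

/-! ### Past and future of the flow -/

theorem Indep.eventuallyMeasurableSpace {Ω : Type*} {_ : MeasurableSpace Ω} {μ : Measure Ω}
    {m₁ m₂ : MeasurableSpace Ω} (h : Indep m₁ m₂ μ) :
    Indep (eventuallyMeasurableSpace m₁ (ae μ)) (eventuallyMeasurableSpace m₂ (ae μ)) μ := by
  rw [Indep_iff] at h ⊢
  rintro A B ⟨A', hA', hA⟩ ⟨B', hB', hB⟩
  rw [measure_congr hA, measure_congr hB, measure_congr (hA.inter hB), h A' B' hA' hB']

/-- Fubini's theorem for independent random elements: the second one may be averaged out with the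
first one frozen. -/
theorem measure_eq_lintegral_of_indepFun {Ω α β : Type*} [MeasurableSpace Ω] [MeasurableSpace α]
    [MeasurableSpace β] {μ : Measure Ω} [IsProbabilityMeasure μ] {Y : Ω → α} {V : Ω → β}
    (hY : Measurable Y) (hV : Measurable V) (h : IndepFun Y V μ) {C : Set (α × β)}
    (hC : MeasurableSet C) :
    μ {ω | (Y ω, V ω) ∈ C} = ∫⁻ ω, μ {ω' | (Y ω, V ω') ∈ C} ∂μ := by
  have := (indepFun_iff_map_prod_eq_prod_map_map hY.aemeasurable hV.aemeasurable).1 h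
  have h1 : μ {ω | (Y ω, V ω) ∈ C} = μ.map (fun ω => (Y ω, V ω)) C :=
    (Measure.map_apply (hY.prodMk hV) hC).symm
  rw [h1, this, Measure.prod_apply hC, lintegral_map (measurable_measure_prodMk_left hC) hY]
  exact lintegral_congr fun ω => Measure.map_apply hV (measurable_prodMk_left hC)

theorem exists_strictMonoOn_enumeration {T : Finset ℝ} (hT : T.Nonempty) :
    ∃ (N : ℕ) (τ : ℕ → ℝ), Monotone τ ∧ StrictMonoOn τ (Iic N) ∧ ∀ t ∈ T, ∃ i ≤ N, τ i = t := by
  have hc : 0 < T.card := hT.card_pos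
  refine ⟨T.card - 1, fun j => T.orderEmbOfFin rfl ⟨min j (T.card - 1), by omega⟩, ?_, ?_, ?_⟩
  · intro i j hij
    exact (T.orderEmbOfFin rfl).monotone (Fin.mk_le_mk.2 (min_le_min_right _ hij))
  · intro i hi j hj hij
    refine (T.orderEmbOfFin rfl).strictMono (Fin.mk_lt_mk.2 ?_)
    rwa [min_eq_left hi, min_eq_left hj]
  · intro t ht
    rw [← Finset.mem_coe, ← Finset.range_orderEmbOfFin T rfl] at ht
    obtain ⟨i, rfl⟩ := ht
    have hi : (i : ℕ) < T.card := i.2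
    refine ⟨i, by omega, ?_⟩
    exact congrArg (T.orderEmbOfFin rfl) (Fin.ext (min_eq_left (Nat.le_sub_one_of_lt hi)))

section Flow

variable {M : Type*} [MetricSpace M] [MeasurableSpace M]
  {P : (n : ℕ) → ℝ≥0 → Kernel (Fin n → M) (Fin n → M)}
  {Ω : Type*} [MeasurableSpace Ω] {μ : Measure Ω} {ψ : ℝ → ℝ → Ω → MeasMap M}

theorem IsStochasticFlow.measurable_apply (hψ : IsStochasticFlow P μ ψ) {s t : ℝ} (hst : s ≤ t)
    (x : M) : Measurable fun ω => (ψ s t ω).1 x :=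
  (measurable_pi_apply x).comp (measurable_subtype_coe.comp (hψ.measurable s t hst))

/-- The `σ`-field generated by the random variables `ψ_{u,v}(z)`, `(u, v) ∈ I`, `z ∈ M`. -/
@[reducible] def flowField (ψ : ℝ → ℝ → Ω → MeasMap M) (I : Set (ℝ × ℝ)) : MeasurableSpace Ω :=
  ⨆ p ∈ {p : (ℝ × ℝ) × M | p.1 ∈ I},
    MeasurableSpace.comap (fun ω => (ψ p.1.1 p.1.2 ω).1 p.2) inferInstance

/-- The events that agree up to a null set with an event determined by the flow up to time `s`. -/
@[reducible] def past (μ : Measure Ω) (ψ : ℝ → ℝ → Ω → MeasMap M) (s : ℝ) : MeasurableSpace Ω :=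
  eventuallyMeasurableSpace (flowField ψ {p | p.1 ≤ p.2 ∧ p.2 ≤ s}) (ae μ)

/-- The events that agree up to a null set with an event determined by the flow after time `s`. -/
@[reducible] def future (μ : Measure Ω) (ψ : ℝ → ℝ → Ω → MeasMap M) (s : ℝ) : MeasurableSpace Ω :=
  eventuallyMeasurableSpace (flowField ψ {p | s ≤ p.1 ∧ p.1 ≤ p.2}) (ae μ)

omit [MetricSpace M] [MeasurableSpace Ω] in
theorem measurable_flowField {I : Set (ℝ × ℝ)} {u v : ℝ} (h : (u, v) ∈ I) (z : M) :
    Measurable[flowField ψ I] fun ω => (ψ u v ω).1 z :=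
  measurable_iff_comap_le.2 (le_iSup₂_of_le (f := fun (p : (ℝ × ℝ) × M) _ =>
    MeasurableSpace.comap (fun ω => (ψ p.1.1 p.1.2 ω).1 p.2) inferInstance) ((u, v), z) h le_rfl)

omit [MetricSpace M] in
theorem measurable_past {s u v : ℝ} (huv : u ≤ v) (hv : v ≤ s) (z : M) :
    Measurable[past μ ψ s] fun ω => (ψ u v ω).1 z :=
  Measurable.eventuallyMeasurable (measurable_flowField (I := {p | p.1 ≤ p.2 ∧ p.2 ≤ s}) ⟨huv, hv⟩ z)

omit [MetricSpace M] in
theorem measurable_future {s u v : ℝ} (hu : s ≤ u) (huv : u ≤ v) :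
    Measurable[future μ ψ s] (ψ u v) :=
  Measurable.subtype_mk (m := future μ ψ s) (@measurable_pi_lambda _ _ _ (future μ ψ s) _ _ fun z =>
    Measurable.eventuallyMeasurable
      (measurable_flowField (I := {p | s ≤ p.1 ∧ p.1 ≤ p.2}) ⟨hu, huv⟩ z))

/-- Along a partition of time the flow is, up to null sets, determined by its increments. -/
theorem IsStochasticFlow.eventuallyMeasurable_of_increments (hψ : IsStochasticFlow P μ ψ)
    {τ : ℕ → ℝ} (hτ : Monotone τ) {a b : ℕ} (hab : a ≤ b) (z : M) :
    ∀ m : MeasurableSpace Ω, (∀ i, a ≤ i → i < b → Measurable[m] (ψ (τ i) (τ (i + 1)))) →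
      EventuallyMeasurable m (ae μ) fun ω => (ψ (τ a) (τ b) ω).1 z := by
  obtain ⟨J, hJ, hflow⟩ := hψ.flow
  have hrefl := hψ.refl
  intro m hm
  induction b, hab using Nat.le_induction with
  | base =>
    have : (fun ω => (ψ (τ a) (τ a) ω).1 z) = fun _ => z := 
      funext fun ω => hrefl _ _ _
    rw [this]
    exact measurable_const
  | succ b hab ih =>
    refine EventuallyMeasurable.congr ?_ (hflow _ _ _ (hτ hab) (hτ b.le_succ) z).2
    have h1 : Measurable[eventuallyMeasurableSpace m (ae μ)] (ψ (τ b) (τ (b + 1))) :=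
      Measurable.eventuallyMeasurable (hm b hab b.lt_succ_self)
    exact (hJ _).comp (Measurable.prodMk h1 (ih fun i hi hib => hm i hi (by omega)))

/-- The past and the future of the flow at time `s` are independent. -/
theorem IsStochasticFlow.indep_past_future [IsProbabilityMeasure μ] (hψ : IsStochasticFlow P μ ψ)
    (s : ℝ) : Indep (past μ ψ s) (future μ ψ s) μ := by
  classical
  refine Indep.eventuallyMeasurableSpace ?_
  let m (p : (ℝ × ℝ) × M) : MeasurableSpace Ω :=
    MeasurableSpace.comap (fun ω => (ψ p.1.1 p.1.2 ω).1 p.2) inferInstance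
  have hle (I : Set (ℝ × ℝ)) (hI : ∀ p ∈ I, p.1 ≤ p.2) :
      ∀ A ∈ piiUnionInter (fun p => {A | MeasurableSet[m p] A}) {p | p.1 ∈ I},
        MeasurableSet A := fun A hA =>
    (iSup₂_le fun p hp => (hψ.measurable_apply (hI p.1 hp) p.2).comap_le :
      ⨆ p ∈ {p : (ℝ × ℝ) × M | p.1 ∈ I}, m p ≤ _) A
      (measurableSet_iSup_of_mem_piiUnionInter m _ A hA)
  unfold flowField
  rw [← generateFrom_piiUnionInter_measurableSet m, ← generateFrom_piiUnionInter_measurableSet m]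
  refine IndepSets.indep' (hle _ fun p hp => hp.1) (hle _ fun p hp => hp.2)
    (isPiSystem_piiUnionInter _ (fun p => @MeasurableSpace.isPiSystem_measurableSet _ (m p)) _)
    (isPiSystem_piiUnionInter _ (fun p => @MeasurableSpace.isPiSystem_measurableSet _ (m p)) _) ?_
  rw [IndepSets_iff]
  rintro _ _ ⟨T₁, hT₁, f₁, hf₁, rfl⟩ ⟨T₂, hT₂, f₂, hf₂, rfl⟩
  -- Refine the time intervals of both finite families of events to one partition that contains `s`.
  let T : Finset ℝ := insert s ((T₁ ∪ T₂).image (fun p => p.1.1) ∪ (T₁ ∪ T₂).image (fun p => p.1.2))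
  obtain ⟨N, τ, hτ, hτN, hτT⟩ := exists_strictMonoOn_enumeration (T := T) ⟨s, by simp [T]⟩
  obtain ⟨k, hkN, hk⟩ := hτT s (by simp [T])
  have hle_iff {i j : ℕ} (hi : i ≤ N) (hj : j ≤ N) : τ i ≤ τ j ↔ i ≤ j := hτN.le_iff_le hi hj
  let c (i : Fin N) : MeasurableSpace Ω := MeasurableSpace.comap (ψ (τ i) (τ (i + 1))) inferInstance
  have hind : Indep (⨆ i ∈ {i : Fin N | (i : ℕ) < k}, c i) (⨆ i ∈ {i : Fin N | k ≤ (i : ℕ)}, c i) μ :=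
    indep_iSup_of_disjoint (fun i => (hψ.measurable _ _ (hτ (Nat.le_succ _))).comap_le)
      ((iIndepFun_iff_iIndep _ _ _).1 (hψ.indep N (fun i => τ i) fun i j hij => hτ hij))
      (disjoint_left.2 fun i hi hi' => by simp only [mem_ofPred_eq] at hi hi'; omega)
  have hinc (S : Set (Fin N)) (i : ℕ) (hi : i < N) (hS : (⟨i, hi⟩ : Fin N) ∈ S) :
      Measurable[⨆ i ∈ S, c i] (ψ (τ i) (τ (i + 1))) :=
    measurable_iff_comap_le.2 (le_iSup₂_of_le (f := fun i _ => c i) ⟨i, hi⟩ hS le_rfl)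
  refine (Indep_iff _ _ _).1 (Indep.eventuallyMeasurableSpace hind) _ _ ?_ ?_
  · refine Finset.measurableSet_biInter _ fun p hp => ?_
    obtain ⟨B, hB, hBf⟩ := hf₁ p hp
    obtain ⟨h1, h2⟩ := hT₁ hp
    obtain ⟨a, ha, hau⟩ := hτT p.1.1 (by simp [T]; grind)
    obtain ⟨b, hb, hbv⟩ := hτT p.1.2 (by simp [T]; grind)
    rw [← hau, ← hbv, hle_iff ha hb] at h1
    rw [← hbv, ← hk, hle_iff hb hkN] at h2
    rw [← hBf, ← hau, ← hbv]
    exact hψ.eventuallyMeasurable_of_increments hτ h1 p.2 _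
      (fun i _ hib => hinc _ i (by omega) (by simp only [mem_ofPred_eq]; omega)) hB
  · refine Finset.measurableSet_biInter _ fun p hp => ?_
    obtain ⟨B, hB, hBf⟩ := hf₂ p hp
    obtain ⟨h1, h2⟩ := hT₂ hp
    obtain ⟨a, ha, hau⟩ := hτT p.1.1 (by simp [T]; grind)
    obtain ⟨b, hb, hbv⟩ := hτT p.1.2 (by simp [T]; grind)
    rw [← hau, ← hbv, hle_iff ha hb] at h2
    rw [← hau, ← hk, hle_iff hkN ha] at h1
    rw [← hBf, ← hau, ← hbv]
    exact hψ.eventuallyMeasurable_of_increments hτ h2 p.2 _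
      (fun i hai hib => hinc _ i (by omega) (by simp only [mem_ofPred_eq]; omega)) hB

theorem IsStochasticFlow.indepFun [IsProbabilityMeasure μ] (hψ : IsStochasticFlow P μ ψ) {s : ℝ}
    {α β : Type*} [MeasurableSpace α] [MeasurableSpace β] {Y : Ω → α} {V : Ω → β}
    (hY : Measurable[past μ ψ s] Y) (hV : Measurable[future μ ψ s] V) : IndepFun Y V μ :=
  (IndepFun_iff_Indep _ _ _).2 (indep_of_indep_of_le_left
    (indep_of_indep_of_le_right (hψ.indep_past_future s) (measurable_iff_comap_le.1 hV))
    (measurable_iff_comap_le.1 hY))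

/-- The law of the `n`-point motion. -/
theorem IsStochasticFlow.map_eq [LocallyCompactSpace M] [SecondCountableTopology M] [BorelSpace M]
    [IsProbabilityMeasure μ] (hFeller : ∀ n, IsFeller (P n)) (hψ : IsStochasticFlow P μ ψ)
    {s t : ℝ} (hst : s ≤ t) {n : ℕ} (z : Fin n → M) :
    μ.map (fun ω i => (ψ s t ω).1 (z i)) = P n (t - s).toNNReal z := by
  have := (hFeller n).markov (t - s).toNNReal
  have hm : Measurable fun ω i => (ψ s t ω).1 (z i) :=
    measurable_pi_lambda _ fun i => hψ.measurable_apply hst (z i)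
  have := Measure.isProbabilityMeasure_map (μ := μ) hm.aemeasurable
  refine measure_ext_of_integral_zeroAtInfty fun f => ?_
  rw [integral_map hm.aemeasurable (map_continuous f).aestronglyMeasurable]
  exact hψ.npoint s t hst n z f

end Flow

/-! ### Almost sure convergence along subsequences -/

/-- Countably many sequences of nonnegative random variables that converge to `0` in mean converge
to `0` almost surely along a common subsequence. -/
theorem exists_subseq_ae_tendsto_zero {Ω : Type*} [MeasurableSpace Ω] {μ : Measure Ω}
    {g : ℕ → ℕ → Ω → ℝ≥0∞} (hg : ∀ i j, Measurable (g i j))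
    (h : ∀ i, Tendsto (fun j => ∫⁻ ω, g i j ω ∂μ) atTop (𝓝 0)) :
    ∃ σ : ℕ → ℕ, StrictMono σ ∧ ∀ᵐ ω ∂μ, ∀ i, Tendsto (fun p => g i (σ p) ω) atTop (𝓝 0) := by
  obtain ⟨σ, hσ, hσg⟩ := extraction_forall_of_eventually'
    (P := fun p j => ∀ i ∈ Iic p, ∫⁻ ω, g i j ω ∂μ < 2⁻¹ ^ p) (fun p => by
      rw [← eventually_atTop, (finite_Iic p).eventually_all]
      exact fun i _ => (h i).eventually_lt_const (ENNReal.pow_pos (by simp) p))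
  refine ⟨σ, hσ, ae_all_iff.2 fun i => ?_⟩
  have hsum : ∫⁻ ω, ∑' p, g i (σ (p + i)) ω ∂μ ≠ ∞ := by
    rw [lintegral_tsum fun p => (hg i _).aemeasurable]
    refine ne_top_of_le_ne_top (b := ∑' p : ℕ, (2⁻¹ : ℝ≥0∞) ^ p) ?_
      (ENNReal.tsum_le_tsum fun p => (hσg (p + i) i (Nat.le_add_left i p)).le.trans ?_)
    · rw [ENNReal.tsum_geometric, ENNReal.one_sub_inv_two, inv_inv]
      simp
    · exact pow_le_pow_right_of_le_one' (by simp) (Nat.le_add_right p i)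
  filter_upwards [ae_lt_top' (AEMeasurable.tsum fun p => (hg i _).aemeasurable) hsum]
    with ω hω
  exact (tendsto_add_atTop_iff_nat i).1 (ENNReal.tendsto_atTop_zero_of_tsum_ne_top hω.ne)

theorem tendsto_of_tendsto_ofReal_sub_sq {u : ℕ → ℝ} {a : ℝ}
    (h : Tendsto (fun p => ENNReal.ofReal ((u p - a) ^ 2)) atTop (𝓝 0)) :
    Tendsto u atTop (𝓝 a) := by
  have h1 := (ENNReal.tendsto_toReal ENNReal.zero_ne_top).comp h
  simp only [Function.comp_def, ENNReal.toReal_ofReal (sq_nonneg _), ENNReal.toReal_zero] at h1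
  have h2 := h1.sqrt
  simp only [Real.sqrt_sq_eq_abs, Real.sqrt_zero] at h2
  exact tendsto_iff_dist_tendsto_zero.2 h2

section Versions

variable {M : Type*} [MetricSpace M] [LocallyCompactSpace M] [SecondCountableTopology M]
  [MeasurableSpace M] [BorelSpace M]
  {P : (n : ℕ) → ℝ≥0 → Kernel (Fin n → M) (Fin n → M)}
  {Ω : Type*} [MeasurableSpace Ω] {μ : Measure Ω} {ψ : ℝ → ℝ → Ω → MeasMap M}

omit [LocallyCompactSpace M] [SecondCountableTopology M] in
/-- The flow is continuous in mean square, jointly in time and space. -/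
theorem IsStochasticFlow.tendsto_lintegral (hψ : IsStochasticFlow P μ ψ) (f : C₀(M, ℝ))
    {s t : ℝ} (hst : s ≤ t) {x : M} {u v : ℕ → ℝ} {y : ℕ → M} (huv : ∀ j, u j ≤ v j)
    (hu : Tendsto u atTop (𝓝 s)) (hv : Tendsto v atTop (𝓝 t)) (hy : Tendsto y atTop (𝓝 x)) :
    Tendsto (fun j => ∫⁻ ω, ENNReal.ofReal
      ((f ((ψ (u j) (v j) ω).1 (y j)) - f ((ψ s t ω).1 x)) ^ 2) ∂μ) atTop (𝓝 0) := by
  have hf (a b : ℝ) (hab : a ≤ b) (z : M) : Measurable fun ω => f ((ψ a b ω).1 z) :=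
    (map_continuous f).measurable.comp (hψ.measurable_apply hab z)
  have h1 := (hψ.time_continuity f s t hst).comp (tendsto_nhdsWithin_iff.2
    ⟨hu.prodMk_nhds hv, Eventually.of_forall fun j => huv j⟩)
  have h2 := (hψ.space_continuity f x s t hst).comp hy
  have h3 := (ENNReal.Tendsto.const_mul (a := 2) h1 (Or.inr (by simp))).add
    (ENNReal.Tendsto.const_mul (a := 2) h2 (Or.inr (by simp)))
  simp only [mul_zero, add_zero] at h3
  refine tendsto_of_tendsto_of_tendsto_of_le_of_le tendsto_const_nhds h3 (fun _ => zero_le)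
    fun j => ?_
  calc ∫⁻ ω, ENNReal.ofReal ((f ((ψ (u j) (v j) ω).1 (y j)) - f ((ψ s t ω).1 x)) ^ 2) ∂μ
      ≤ ∫⁻ ω, (2 * ENNReal.ofReal ((f ((ψ (u j) (v j) ω).1 (y j)) - f ((ψ s t ω).1 (y j))) ^ 2) +
          2 * ENNReal.ofReal ((f ((ψ s t ω).1 (y j)) - f ((ψ s t ω).1 x)) ^ 2)) ∂μ := by
        refine lintegral_mono fun ω => ?_
        simp only
        rw [← ENNReal.ofReal_ofNat 2, ← ENNReal.ofReal_mul (by norm_num),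
          ← ENNReal.ofReal_mul (by norm_num),
          ← ENNReal.ofReal_add (by positivity) (by positivity)]
        refine ENNReal.ofReal_le_ofReal ?_
        nlinarith [sq_nonneg ((f ((ψ (u j) (v j) ω).1 (y j)) - f ((ψ s t ω).1 (y j))) -
          (f ((ψ s t ω).1 (y j)) - f ((ψ s t ω).1 x)))]
    _ = 2 * ∫⁻ ω, ENNReal.ofReal
            ((f ((ψ (u j) (v j) ω).1 (y j)) - f ((ψ s t ω).1 (y j))) ^ 2) ∂μ +
          2 * ∫⁻ ω, ENNReal.ofReal ((f ((ψ s t ω).1 (y j)) - f ((ψ s t ω).1 x)) ^ 2) ∂μ := by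
        have m1 : Measurable fun ω => ENNReal.ofReal
            ((f ((ψ (u j) (v j) ω).1 (y j)) - f ((ψ s t ω).1 (y j))) ^ 2) :=
          (((hf _ _ (huv j) _).sub (hf _ _ hst _)).pow_const 2).ennreal_ofReal
        have m2 : Measurable fun ω => ENNReal.ofReal
            ((f ((ψ s t ω).1 (y j)) - f ((ψ s t ω).1 x)) ^ 2) :=
          (((hf _ _ hst _).sub (hf _ _ hst _)).pow_const 2).ennreal_ofReal
        rw [lintegral_add_left (m1.const_mul 2), lintegral_const_mul _ m1,
          lintegral_const_mul _ m2]
    _ ≤ _ := by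
        refine add_le_add (mul_le_mul_right ?_ 2) le_rfl
        exact le_iSup (fun z : M => ∫⁻ ω, ENNReal.ofReal
          ((f ((ψ (u j) (v j) ω).1 z) - f ((ψ s t ω).1 z)) ^ 2) ∂μ) (y j)

/-- If `(s_j, x_j) → (s, x)`, then along a subsequence `ψ_{s_j,t}(x_j) → ψ_{s,t}(x)` a.s.,
simultaneously for countably many times `t ≥ s`. -/
theorem IsStochasticFlow.exists_subseq_tendsto (hψ : IsStochasticFlow P μ ψ) {s : ℝ} {x : M}
    {u : ℕ → ℝ} {y : ℕ → M} (hu : Tendsto u atTop (𝓝 s)) (hy : Tendsto y atTop (𝓝 x))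
    {T : ℕ → ℝ} (hT : ∀ l, s ≤ T l) :
    ∃ σ : ℕ → ℕ, StrictMono σ ∧ ∀ᵐ ω ∂μ, ∀ l,
      Tendsto (fun p => (ψ (u (σ p)) (max (T l) (u (σ p))) ω).1 (y (σ p))) atTop
        (𝓝 ((ψ s (T l) ω).1 x)) := by
  have : Nonempty M := ⟨x⟩
  obtain ⟨σ, hσ, h⟩ := exists_subseq_ae_tendsto_zero (μ := μ)
    (g := fun i j ω => ENNReal.ofReal
      ((testFun M i.unpair.1 ((ψ (u j) (max (T i.unpair.2) (u j)) ω).1 (y j)) -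
        testFun M i.unpair.1 ((ψ s (T i.unpair.2) ω).1 x)) ^ 2))
    (fun i j => ((((map_continuous _).measurable.comp
      (hψ.measurable_apply (le_max_right _ _) _)).sub ((map_continuous _).measurable.comp
      (hψ.measurable_apply (hT _) _))).pow_const 2).ennreal_ofReal)
    (fun i => hψ.tendsto_lintegral _ (hT _) (fun j => le_max_right _ _) hu
      (by simpa [max_eq_left (hT i.unpair.2)] using (tendsto_const_nhds (x := T i.unpair.2)).max hu)
      hy)
  refine ⟨σ, hσ, ?_⟩
  filter_upwards [h] with ω hω l
  refine tendsto_of_tendsto_testFun fun m => tendsto_of_tendsto_ofReal_sub_sq ?_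
  simpa using hω (Nat.pair m l)

/-! ### Continuous versions of the trajectories of the flow -/

/-- `Z` is a continuous modification of the trajectory `ψ_{s,·}(x)` whose paths are limits of pieces
of the paths `Φ` that start close to `(s, x)`. -/
structure IsPathVersion (μ : Measure Ω) (ψ : ℝ → ℝ → Ω → MeasMap M) (Φ : Ω → ℕ → PathSpace M)
    (s : ℝ) (x : M) (Z : Ω → PathSpace M) : Prop where
  measurable : Measurable Z
  start_eq : ∀ᵐ ω ∂μ, (Z ω).start = s
  ae_eq : ∀ t, s ≤ t → ∀ᵐ ω ∂μ, (Z ω).ext t = (ψ s t ω).1 x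
  mem_closure : ∀ L : Set (ℝ × M), IsCompact L → (s, x) ∈ interior L →
    ∀ᵐ ω ∂μ, Z ω ∈ closure (pieces (Φ ω) L)

/-- A countable dense set of times in `[s, ∞)`. -/
noncomputable def denseTime (s : ℝ) (l : ℕ) : ℝ := s + TopologicalSpace.denseSeq ℝ≥0 l

theorem le_denseTime (s : ℝ) (l : ℕ) : s ≤ denseTime s l := by
  simp [denseTime]

theorem eq_of_eq_denseTime {X : Type*} [TopologicalSpace X] [T2Space X] {s : ℝ} {f g : ℝ → X}
    (hf : Continuous f) (hg : Continuous g) (h : ∀ l, f (denseTime s l) = g (denseTime s l))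
    {t : ℝ} (ht : s ≤ t) : f t = g t := by
  have hc : Continuous fun q : ℝ≥0 => s + (q : ℝ) := by fun_prop
  have := congrFun ((TopologicalSpace.denseRange_denseSeq ℝ≥0).equalizer (hf.comp hc) (hg.comp hc)
    (funext fun l => h l)) (t - s).toNNReal
  simpa [Real.coe_toNNReal _ (sub_nonneg.2 ht)] using this

variable {Φ : Ω → ℕ → PathSpace M} {s : ℝ} {x : M}

/-- Versions of the trajectories that start from a sequence `(s_j, x_j) → (s, x)` converge, along a
subsequence, to a version of the trajectory that starts from `(s, x)`. By the skeleton property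
they form a relatively compact sequence, and the continuity of the flow in mean square identifies
the values of its limit points on a dense set of times. -/
theorem exists_subseq_tendsto_isPathVersion (hψ : IsStochasticFlow P μ ψ)
    (hΦ : ∀ᵐ ω ∂μ, IsSkeleton (Φ ω)) {u : ℕ → ℝ} {y : ℕ → M} (hu : Tendsto u atTop (𝓝 s))
    (hy : Tendsto y atTop (𝓝 x)) {Z : ℕ → Ω → PathSpace M}
    (hZ : ∀ j, IsPathVersion μ ψ Φ (u j) (y j) (Z j)) :
    ∃ (σ : ℕ → ℕ) (Z' : Ω → PathSpace M), StrictMono σ ∧ IsPathVersion μ ψ Φ s x Z' ∧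
      ∀ᵐ ω ∂μ, Tendsto (fun p => Z (σ p) ω) atTop (𝓝 (Z' ω)) := by
  have huy := hu.prodMk_nhds hy
  obtain ⟨L, hL, hLx⟩ := exists_compact_mem_nhds (s, x)
  obtain ⟨σ, hσ, hσψ⟩ := hψ.exists_subseq_tendsto hu hy (le_denseTime s)
  have hstart : ∀ᵐ ω ∂μ, ∀ j, (Z j ω).start = u j := ae_all_iff.2 fun j => (hZ j).start_eq
  -- For `t < u j` both sides equal the starting point of `Z j`.
  have hval (t : ℝ) : ∀ᵐ ω ∂μ, ∀ j, (Z j ω).ext t = (ψ (u j) (max t (u j)) ω).1 (y j) := by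
    filter_upwards [ae_all_iff.2 fun j => (hZ j).ae_eq (max t (u j)) (le_max_right _ _), hstart]
      with ω h1 h2 j
    rw [← h1 j]
    rcases le_total (u j) t with h | h
    · rw [max_eq_left h]
    · rw [max_eq_right h, ← h2 j]
      exact PathSpace.ext_of_le_start _ (by rwa [h2 j])
  have hmem (L : Set (ℝ × M)) (hL : IsCompact L) : ∀ᵐ ω ∂μ, ∀ j, (u j, y j) ∈ interior L →
      Z j ω ∈ closure (pieces (Φ ω) L) := by
    refine ae_all_iff.2 fun j => ?_
    by_cases h : (u j, y j) ∈ interior L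
    · filter_upwards [(hZ j).mem_closure L hL h] with ω hω _ using hω
    · exact Eventually.of_forall fun ω h' => absurd h' h
  have hlim : ∀ᵐ ω ∂μ, ∃ g, Tendsto (fun p => Z (σ p) ω) atTop (𝓝 g) := by
    filter_upwards [hΦ, hσψ, hstart, ae_all_iff.2 fun l => hval (denseTime s l), hmem L hL]
      with ω h1 h2 h3 h4 h5
    have hev : ∀ᶠ p in atTop, Z (σ p) ω ∈ closure (pieces (Φ ω) L) :=
      (hσ.tendsto_atTop.eventually (huy.eventually (isOpen_interior.mem_nhds
        (mem_interior_iff_mem_nhds.2 hLx)))).mono fun p hp => h5 _ hp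
    have hc := h1.isCompact_closure_pieces hL
    have hcl (W : PathSpace M) (hW : MapClusterPt W atTop fun p => Z (σ p) ω) :
        W.start = s ∧ ∀ l, W.ext (denseTime s l) = (ψ s (denseTime s l) ω).1 x := by
      constructor
      · refine eq_of_mapClusterPt_of_tendsto
          (hW.continuousAt_comp PathSpace.continuous_start.continuousAt) ?_
        exact (hu.comp hσ.tendsto_atTop).congr fun p => (h3 _).symm
      · intro l
        refine eq_of_mapClusterPt_of_tendsto (hW.continuousAt_comp
          (f := fun f : PathSpace M => f.ext (denseTime s l))
          (PathSpace.continuous_ext_apply_const (denseTime s l)).continuousAt) ?_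
        exact (h2 l).congr fun p => (h4 l _).symm
    obtain ⟨g, -, hg⟩ := hc.exists_mapClusterPt (f := atTop) (u := fun p => Z (σ p) ω)
      (le_principal_iff.2 hev)
    refine ⟨g, hc.tendsto_nhds_of_unique_mapClusterPt hev fun W _ hW => ?_⟩
    refine PathSpace.eq_of_ext_eqOn ((hcl W hW).1.trans (hcl g hg).1.symm) fun t ht => ?_
    exact eq_of_eq_denseTime (map_continuous _) (map_continuous _)
      (fun l => ((hcl W hW).2 l).trans ((hcl g hg).2 l).symm) ((hcl W hW).1 ▸ ht)
  obtain ⟨Z', hZ'm, hZ'⟩ := measurable_limit_of_tendsto_metrizable_ae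
    (fun p => (hZ (σ p)).measurable.aemeasurable) hlim
  refine ⟨σ, Z', hσ, ⟨hZ'm, ?_, fun t ht => ?_, fun L hL hLx => ?_⟩, hZ'⟩
  · filter_upwards [hZ', hstart] with ω h1 h2
    refine tendsto_nhds_unique ((PathSpace.continuous_start.tendsto _).comp h1) ?_
    exact (hu.comp hσ.tendsto_atTop).congr fun p => (h2 _).symm
  · obtain ⟨σ', hσ', h⟩ := hψ.exists_subseq_tendsto (hu.comp hσ.tendsto_atTop)
      (hy.comp hσ.tendsto_atTop) (T := fun _ => t) fun _ => ht
    filter_upwards [hZ', hval t, h] with ω h1 h2 h3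
    refine tendsto_nhds_unique (((PathSpace.continuous_ext_apply_const t).tendsto _).comp
      (h1.comp hσ'.tendsto_atTop)) ?_
    exact (h3 0).congr fun p => (h2 _).symm
  · filter_upwards [hZ', hmem L hL] with ω h1 h2
    refine isClosed_closure.mem_of_tendsto h1 ?_
    exact (hσ.tendsto_atTop.eventually (huy.eventually (isOpen_interior.mem_nhds hLx))).mono
      fun p hp => h2 _ hp

omit [LocallyCompactSpace M] [SecondCountableTopology M] [BorelSpace M] in
theorem IsSkeletonVersion.isPathVersion {D : ℕ → ℝ × M} (hΦ : IsSkeletonVersion μ ψ D Φ) (n : ℕ) :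
    IsPathVersion μ ψ Φ (D n).1 (D n).2 (fun ω => Φ ω n) where
  measurable := (measurable_pi_apply n).comp hΦ.measurable
  start_eq := Eventually.of_forall fun ω => hΦ.start_eq ω n
  ae_eq t ht := hΦ.ae_eq n t ht
  mem_closure L _ h := Eventually.of_forall fun ω => subset_closure (mem_pieces_self (by
    rw [hΦ.start_eq, hΦ.initial]
    exact interior_subset h))

theorem exists_isPathVersion (hψ : IsStochasticFlow P μ ψ) {D : ℕ → ℝ × M} (hD : DenseRange D)
    (hΦ : IsSkeletonVersion μ ψ D Φ) (hΦ' : ∀ᵐ ω ∂μ, IsSkeleton (Φ ω)) (s : ℝ) (x : M) :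
    ∃ Z, IsPathVersion μ ψ Φ s x Z := by
  obtain ⟨d, hd, hdlim⟩ := mem_closure_iff_seq_limit.1
    (hD.closure_eq.symm ▸ mem_univ ((s, x) : ℝ × M))
  choose n hn using hd
  obtain ⟨σ, Z, -, hZ, -⟩ := exists_subseq_tendsto_isPathVersion hψ hΦ'
    ((continuous_fst.tendsto _).comp hdlim) ((continuous_snd.tendsto _).comp hdlim)
    (Z := fun j ω => Φ ω (n j)) fun j => by
      simpa only [Function.comp_apply, ← hn j] using hΦ.isPathVersion (n j)
  exact ⟨Z, hZ⟩

end Versions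

/-! ### The law of the two-point motion -/

section PairPath

variable {M : Type*} [TopologicalSpace M]

/-- The pair of the paths `f` and `g`, observed from time `s` on. -/
def pairPath (s : ℝ) (f g : PathSpace M) : C(ℝ≥0, Fin 2 → M) :=
  ⟨fun t => ![f.ext (s + t), g.ext (s + t)], by
    refine continuous_pi fun i => ?_
    fin_cases i
    · exact (map_continuous f.ext).comp (by fun_prop)
    · exact (map_continuous g.ext).comp (by fun_prop)⟩

/-- The path `f`, observed from time `s` on and shifted to time `0`. -/
def shiftPath (s : ℝ) (f : PathSpace M) : C(ℝ, M) :=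
  ⟨fun t => f.ext (s + t.toNNReal), (map_continuous f.ext).comp (by fun_prop)⟩

theorem shiftPath_apply_sub {s t : ℝ} (ht : s ≤ t) (f : PathSpace M) :
    shiftPath s f (t - s) = f.ext t := by
  change f.ext (s + ((t - s).toNNReal : ℝ)) = f.ext t
  rw [Real.coe_toNNReal _ (sub_nonneg.2 ht), add_sub_cancel]

theorem continuous_shiftPath (s : ℝ) : Continuous (shiftPath (M := M) s) := by
  refine ContinuousMap.continuous_of_continuous_uncurry _ ?_
  exact PathSpace.continuous_ext_apply.comp (continuous_fst.prodMk
    (by fun_prop : Continuous fun p : PathSpace M × ℝ => s + (p.2.toNNReal : ℝ)))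

theorem continuous_coordExt (i : Fin 2) :
    Continuous fun w : C(ℝ≥0, Fin 2 → M) => coordExt w i := by
  refine ContinuousMap.continuous_of_continuous_uncurry _ ?_
  exact (continuous_apply i).comp (continuous_eval.comp (continuous_fst.prodMk
    (by fun_prop : Continuous fun p : C(ℝ≥0, Fin 2 → M) × ℝ => p.2.toNNReal)))

theorem IsCompatibleDist.continuous {δ : C(ℝ, M) → C(ℝ, M) → ℝ} (hδ : IsCompatibleDist δ) :
    Continuous fun p : C(ℝ, M) × C(ℝ, M) => δ p.1 p.2 := by
  refine continuous_iff_continuousAt.2 fun ⟨f, g⟩ => Metric.nhds_basis_ball.tendsto_right_iff.2 ?_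
  intro r hr
  have hf := (hδ.nhds_basis f).mem_of_mem (half_pos hr)
  have hg := (hδ.nhds_basis g).mem_of_mem (half_pos hr)
  filter_upwards [prod_mem_nhds hf hg] with ⟨f', g'⟩ ⟨h1, h2⟩
  simp only [mem_ofPred_eq] at h1 h2
  rw [Metric.mem_ball, Real.dist_eq, abs_lt]
  have h3 := hδ.triangle f' f g'
  have h4 := hδ.triangle f g g'
  have h5 := hδ.triangle f f' g
  have h6 := hδ.triangle f' g' g
  rw [hδ.symm g g'] at h4
  rw [hδ.symm f f'] at h5
  constructor <;> simp only <;> linarith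

/-- The pairs of paths whose coordinates are at distance at least `2^{-k}`. -/
def separatedSet (δ : C(ℝ, M) → C(ℝ, M) → ℝ) (k : ℕ) : Set C(ℝ≥0, Fin 2 → M) :=
  {w | (2⁻¹ : ℝ) ^ k ≤ δ (coordExt w 0) (coordExt w 1)}

theorem measurableSet_separatedSet {δ : C(ℝ, M) → C(ℝ, M) → ℝ} (hδ : IsCompatibleDist δ) (k : ℕ) :
    MeasurableSet (separatedSet δ k) :=
  (isClosed_le continuous_const (hδ.continuous.comp
    ((continuous_coordExt 0).prodMk (continuous_coordExt 1)))).measurableSet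

end PairPath

section TwoPoint

variable {M : Type*} [MetricSpace M] [LocallyCompactSpace M] [SecondCountableTopology M]
  [MeasurableSpace M] [BorelSpace M]
  {P : (n : ℕ) → ℝ≥0 → Kernel (Fin n → M) (Fin n → M)}
  {Ω : Type*} [MeasurableSpace Ω] {μ : Measure Ω} {ψ : ℝ → ℝ → Ω → MeasMap M}
  {Φ : Ω → ℕ → PathSpace M} {s : ℝ} {x y : M} {Z Z' : Ω → PathSpace M}

omit [LocallyCompactSpace M] in
theorem measurable_pairPath (s : ℝ) {f g : Ω → PathSpace M} (hf : Measurable f)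
    (hg : Measurable g) : Measurable fun ω => pairPath s (f ω) (g ω) := by
  refine measurable_of_eval fun t => measurable_pi_lambda _ fun i => ?_
  fin_cases i
  · exact (PathSpace.measurable_ext_apply_const _).comp hf
  · exact (PathSpace.measurable_ext_apply_const _).comp hg

/-- The pair of versions of the trajectories of `ψ_{s,·}` at `x` and `y` is a Markov process with
transition function `P 2`. The values up to time `s + r` depend on the past, and the values at time
`s + r + t` are obtained from those at time `s + r` by the independent random map
`ψ_{s+r,s+r+t}`. -/
theorem isMarkovLaw_pairPath [IsProbabilityMeasure μ] (hFeller : ∀ n, IsFeller (P n))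
    (hψ : IsStochasticFlow P μ ψ) (hZ : IsPathVersion μ ψ Φ s x Z)
    (hZ' : IsPathVersion μ ψ Φ s y Z') :
    IsMarkovLaw (P 2) ![x, y] (μ.map fun ω => pairPath s (Z ω) (Z' ω)) := by
  set W : Ω → C(ℝ≥0, Fin 2 → M) := fun ω => pairPath s (Z ω) (Z' ω) with hW
  have hWm : Measurable W := measurable_pairPath s hZ.measurable hZ'.measurable
  have hWe (t : ℝ≥0) : Measurable fun ω => W ω t := (measurable_eval_const t).comp hWm
  have hval (t : ℝ≥0) : ∀ᵐ ω ∂μ, ∀ i, W ω t i = (ψ s (s + t) ω).1 (![x, y] i) := by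
    filter_upwards [hZ.ae_eq (s + t) (by simp), hZ'.ae_eq (s + t) (by simp)] with ω h1 h2
    rw [Fin.forall_fin_two]
    exact ⟨h1, h2⟩
  refine ⟨Measure.isProbabilityMeasure_map hWm.aemeasurable, ?_, fun r t A hA B hB => ?_⟩
  · refine (ae_map_iff hWm.aemeasurable
      ((measurable_eval_const (0 : ℝ≥0)) (measurableSet_singleton ![x, y]))).2 ?_
    filter_upwards [hval 0] with ω hω
    funext i
    simpa [hψ.refl] using hω i
  · obtain ⟨J, hJ, hflow⟩ := hψ.flow
    have hAm : MeasurableSet A := (iSup_le fun r' : Iic r => (measurable_eval_const r'.1).comap_le :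
      ⨆ r' : Iic r, MeasurableSpace.comap (fun w : C(ℝ≥0, Fin 2 → M) => w r'.1) inferInstance ≤ _)
      A hA
    have hpast (r' : ℝ≥0) (hr' : r' ≤ r) : Measurable[past μ ψ (s + r)] fun ω => W ω r' := by
      refine @measurable_pi_lambda _ _ _ (past μ ψ (s + r)) _ _ fun i => ?_
      refine EventuallyMeasurable.congr (measurable_past (u := s) (v := s + r') (by simp)
        (by simpa using hr') (![x, y] i)) ?_
      filter_upwards [hval r'] with ω hω using hω i
    have hApast : MeasurableSet[past μ ψ (s + r)] (W ⁻¹' A) := by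
      have : MeasurableSpace.comap W (⨆ r' : Iic r,
          MeasurableSpace.comap (fun w : C(ℝ≥0, Fin 2 → M) => w r'.1) inferInstance) ≤
          past μ ψ (s + r) := by
        simp only [MeasurableSpace.comap_iSup, MeasurableSpace.comap_comp]
        exact iSup_le fun r' => measurable_iff_comap_le.1 (hpast r'.1 r'.2)
      exact this _ ⟨A, hA, rfl⟩
    -- The past event and the position at time `s + r`, as one random element of the past.
    let Y : Ω → Prop × (Fin 2 → M) := fun ω => (ω ∈ W ⁻¹' A, W ω r)
    have hYpast : Measurable[past μ ψ (s + r)] Y :=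
      Measurable.prodMk ((@measurable_mem _ _ (past μ ψ (s + r))).2 hApast) (hpast r le_rfl)
    have hY : Measurable Y := (measurable_mem.2 (hWm hAm)).prodMk (hWe r)
    let V : Ω → MeasMap M := ψ (s + r) (s + r + t)
    have hV : Measurable V := hψ.measurable _ _ (by simp)
    have hind : IndepFun Y V μ :=
      hψ.indepFun hYpast (measurable_future le_rfl (by simp))
    let C : Set ((Prop × (Fin 2 → M)) × MeasMap M) :=
      {p | p.1.1 ∧ (fun i => J t (p.2, p.1.2 i)) ∈ B}
    have hC : MeasurableSet C := by
      refine MeasurableSet.inter (s₁ := {p : (Prop × (Fin 2 → M)) × MeasMap M | p.1.1})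
        (s₂ := {p : (Prop × (Fin 2 → M)) × MeasMap M | (fun i => J t (p.2, p.1.2 i)) ∈ B})
        (measurableSet_setOfPred.2 (measurable_fst.comp measurable_fst)) ?_
      refine measurable_pi_lambda _ (fun i => (hJ t).comp (measurable_snd.prodMk
        ((measurable_pi_apply i).comp (measurable_snd.comp measurable_fst)))) hB
    have hJt : ((s + r + t) - (s + r)).toNNReal = t := by simp
    have hmove : ∀ᵐ ω ∂μ, W ω (r + t) = fun i => J t (V ω, W ω r i) := by
      have h (i : Fin 2) := (hflow s (s + r) (s + r + t) (by simp) (by simp) (![x, y] i)).2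
      filter_upwards [hval r, hval (r + t), h 0, h 1] with ω h1 h2 h3 h4
      have h34 : ∀ i, (ψ s (s + r + t) ω).1 (![x, y] i) =
          J ((s + r + t) - (s + r)).toNNReal (ψ (s + r) (s + r + t) ω,
            (ψ s (s + r) ω).1 (![x, y] i)) := Fin.forall_fin_two.2 ⟨h3, h4⟩
      funext i
      rw [h2 i, h1 i, NNReal.coe_add, ← add_assoc, h34 i, hJt]
    have hkernel (z : Fin 2 → M) :
        μ {ω | (fun i => J t (V ω, z i)) ∈ B} = P 2 t z B := by
      have h := hψ.map_eq hFeller (s := s + r) (t := s + r + t) (by simp) z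
      rw [hJt] at h
      rw [← h, Measure.map_apply (measurable_pi_lambda _ fun i =>
        hψ.measurable_apply (by simp) (z i)) hB]
      refine measure_congr (eventuallyEq_set.2 ?_)
      have h' (i : Fin 2) := (hflow (s + r) (s + r + t) (s + r + t) (by simp) le_rfl (z i)).1
      filter_upwards [h' 0, h' 1] with ω h3 h4
      have h34 : ∀ i, J ((s + r + t) - (s + r)).toNNReal (ψ (s + r) (s + r + t) ω, z i) =
          (ψ (s + r) (s + r + t) ω).1 (z i) := Fin.forall_fin_two.2 ⟨h3, h4⟩
      simp only [hJt] at h34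
      simp only [V, h34, mem_preimage]
    have hker : Measurable fun w : C(ℝ≥0, Fin 2 → M) => P 2 t (w r) B :=
      (Kernel.measurable_coe (P 2 t) hB).comp (measurable_eval_const r)
    rw [Measure.map_apply hWm (hAm.inter (show MeasurableSet {w : C(ℝ≥0, Fin 2 → M) | w (r + t) ∈ B}
        from measurable_eval_const _ hB)),
      Measure.restrict_map hWm hAm, lintegral_map hker hWm]
    calc μ (W ⁻¹' (A ∩ {w | w (r + t) ∈ B})) = μ {ω | (Y ω, V ω) ∈ C} := by
          refine measure_congr (eventuallyEq_set.2 ?_)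
          filter_upwards [hmove] with ω hω
          change (W ω ∈ A ∧ W ω (r + t) ∈ B) ↔ (W ω ∈ A ∧ (fun i => J t (V ω, W ω r i)) ∈ B)
          rw [hω]
      _ = ∫⁻ ω, μ {ω' | (Y ω, V ω') ∈ C} ∂μ := measure_eq_lintegral_of_indepFun hY hV hind hC
      _ = ∫⁻ ω in W ⁻¹' A, P 2 t (W ω r) B ∂μ := by
          rw [← lintegral_indicator (hWm hAm)]
          refine lintegral_congr fun ω => ?_
          by_cases hω : ω ∈ W ⁻¹' A
          · rw [indicator_of_mem hω, ← hkernel]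
            congr 1
            ext ω'
            simp only [mem_ofPred_eq, C, Y, hω, true_and]
          · rw [indicator_of_notMem hω]
            simp only [C, Y, hω, false_and, mem_ofPred_eq, ofPred_false, measure_empty]

theorem separationProb_eq [IsProbabilityMeasure μ] (hFeller : ∀ n, IsFeller (P n))
    (hψ : IsStochasticFlow P μ ψ) {δ : C(ℝ, M) → C(ℝ, M) → ℝ} (hδ : IsCompatibleDist δ)
    (hZ : IsPathVersion μ ψ Φ s x Z) (hZ' : IsPathVersion μ ψ Φ s y Z') (k : ℕ) :
    separationProb δ P k x y =
      μ {ω | (2⁻¹ : ℝ) ^ k ≤ δ (shiftPath s (Z ω)) (shiftPath s (Z' ω))} := by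
  rw [separationProb, pathLaw_eq (isMarkovLaw_pairPath hFeller hψ hZ hZ')]
  exact Measure.map_apply (measurable_pairPath s hZ.measurable hZ'.measurable)
    (measurableSet_separatedSet hδ k)

/-! ### The functions `ε_k` -/

/-- The data from which `θ` is built: a flow associated with Feller transition functions, together
with a skeleton that starts from a dense sequence. -/
structure IsFlowWithSkeleton (P : (n : ℕ) → ℝ≥0 → Kernel (Fin n → M) (Fin n → M))
    (μ : Measure Ω) (ψ : ℝ → ℝ → Ω → MeasMap M) (D : ℕ → ℝ × M) (Φ : Ω → ℕ → PathSpace M) :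
    Prop where
  feller : ∀ n, IsFeller (P n)
  flow : IsStochasticFlow P μ ψ
  dense : DenseRange D
  version : IsSkeletonVersion μ ψ D Φ
  skeleton : ∀ᵐ ω ∂μ, IsSkeleton (Φ ω)

variable {D : ℕ → ℝ × M} {δ : C(ℝ, M) → C(ℝ, M) → ℝ}

/-- The function `(x, y) ↦ ℙ_{(x,y)}[d₀(X, Y) ≥ 2^{-k}]` is upper semicontinuous. -/
theorem IsFlowWithSkeleton.isClosed_le_separationProb [IsProbabilityMeasure μ]
    (h : IsFlowWithSkeleton P μ ψ D Φ) (hδ : IsCompatibleDist δ) (k : ℕ) (c : ℝ≥0∞) :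
    IsClosed {p : M × M | c ≤ separationProb δ P k p.1 p.2} := by
  refine IsSeqClosed.isClosed fun p q hp hpq => ?_
  have hex := exists_isPathVersion h.flow h.dense h.version h.skeleton 0
  choose Z hZ using hex
  obtain ⟨σ₁, X, hσ₁, hX, hXlim⟩ := exists_subseq_tendsto_isPathVersion h.flow h.skeleton
    (tendsto_const_nhds (x := (0 : ℝ))) ((continuous_fst.tendsto _).comp hpq)
    fun j => hZ (p j).1
  obtain ⟨σ₂, Y, hσ₂, hY, hYlim⟩ := exists_subseq_tendsto_isPathVersion h.flow h.skeleton
    (tendsto_const_nhds (x := (0 : ℝ)))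
    (((continuous_snd.tendsto _).comp hpq).comp hσ₁.tendsto_atTop)
    fun j => hZ (p (σ₁ j)).2
  set E : ℕ → Set Ω := fun j =>
    {ω | (2⁻¹ : ℝ) ^ k ≤
      δ (shiftPath 0 (Z (p (σ₁ (σ₂ j))).1 ω)) (shiftPath 0 (Z (p (σ₁ (σ₂ j))).2 ω))} with hE
  have hEm (j : ℕ) : MeasurableSet (E j) :=
    measurable_pairPath 0 (hZ _).measurable (hZ _).measurable (measurableSet_separatedSet hδ k)
  have hEc (j : ℕ) : c ≤ μ (E j) := by
    rw [hE, ← separationProb_eq h.feller h.flow hδ (hZ _) (hZ _) k]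
    exact hp _
  simp only [mem_ofPred_eq]
  rw [separationProb_eq h.feller h.flow hδ hX hY k]
  -- The events `E j` have probability at least `c`, hence so does their limsup, on which the limit
  -- paths `X` and `Y` are separated as well.
  have hlim : Tendsto (fun J => μ (⋃ j ≥ J, E j)) atTop (𝓝 (μ (⋂ J, ⋃ j ≥ J, E j))) := by
    refine tendsto_measure_iInter_atTop (fun J => (MeasurableSet.biUnion (to_countable _)
      fun j _ => hEm j).nullMeasurableSet) (fun J J' hJ => ?_) ⟨0, measure_ne_top _ _⟩
    exact biUnion_subset_biUnion_left fun j hj => hJ.trans hj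
  refine (ge_of_tendsto' hlim fun J => (hEc J).trans (measure_mono
    (subset_iUnion₂ (s := fun j (_ : j ≥ J) => E j) J le_rfl))).trans
    (measure_mono_ae ?_)
  filter_upwards [hXlim, hYlim] with ω h1 h2 hω
  have hd : Tendsto (fun j => δ (shiftPath 0 (Z (p (σ₁ (σ₂ j))).1 ω))
      (shiftPath 0 (Z (p (σ₁ (σ₂ j))).2 ω))) atTop (𝓝 (δ (shiftPath 0 (X ω)) (shiftPath 0 (Y ω)))) :=
    (hδ.continuous.tendsto (shiftPath 0 (X ω), shiftPath 0 (Y ω))).comp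
      ((((continuous_shiftPath 0).tendsto _).comp (h1.comp hσ₂.tendsto_atTop)).prodMk_nhds
        (((continuous_shiftPath 0).tendsto _).comp h2))
  refine ge_of_tendsto_of_frequently hd (frequently_atTop.2 fun J => ?_)
  obtain ⟨j, hj, hjE⟩ := mem_iUnion₂.1 (mem_iInter.1 hω J)
  exact ⟨j, hj, hjE⟩

theorem IsFlowWithSkeleton.separationProb_self [IsProbabilityMeasure μ]
    (h : IsFlowWithSkeleton P μ ψ D Φ) (hδ : IsCompatibleDist δ) (k : ℕ) (x : M) :
    separationProb δ P k x x = 0 := by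
  obtain ⟨Z, hZ⟩ := exists_isPathVersion h.flow h.dense h.version h.skeleton 0 x
  rw [separationProb_eq h.feller h.flow hδ hZ hZ k]
  refine measure_mono_null (t := ∅) (fun ω hω => ?_) measure_empty
  rw [mem_ofPred_eq, (hδ.eq_zero_iff _ _).2 rfl] at hω
  exact absurd hω (not_le.2 (by positivity))

section Epsilon

omit [LocallyCompactSpace M] [SecondCountableTopology M] [BorelSpace M]

theorem bddBelow_epsilon (k : ℕ) (x : M) : BddBelow (insert ((2⁻¹ : ℝ) ^ k)
    {r : ℝ | 0 < r ∧ (2⁻¹ : ℝ≥0∞) ^ k <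
      ⨆ y ∈ Metric.closedBall x r, separationProb δ P k x y}) :=
  BddBelow.insert _ ⟨0, fun _ hr => hr.1.le⟩

theorem epsilon_le (k : ℕ) (x : M) : epsilon δ P k x ≤ 2⁻¹ ^ k :=
  csInf_le (bddBelow_epsilon k x) (mem_insert _ _)

/-- Points at distance less than `ε_k(x)` from `x` are seldom separated from `x`. -/
theorem separationProb_le_of_dist_lt {k : ℕ} {x y : M} (hy : dist y x < epsilon δ P k x) :
    separationProb δ P k x y ≤ 2⁻¹ ^ k := by
  obtain ⟨r, hr, hrε⟩ := exists_between hy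
  by_contra! hcon
  refine hrε.not_ge (csInf_le (bddBelow_epsilon k x) (mem_insert_of_mem _
    ⟨dist_nonneg.trans_lt hr, hcon.trans_le ?_⟩))
  exact le_iSup₂_of_le (f := fun y _ => separationProb δ P k x y) y hr.le le_rfl

theorem epsilon_lt_iff {k : ℕ} {x : M} {a : ℝ} : epsilon δ P k x < a ↔ (2⁻¹ : ℝ) ^ k < a ∨
    ∃ q : ℚ, (q : ℝ) < a ∧ ∃ m : ℕ, ∃ y, dist y x ≤ q ∧
      2⁻¹ ^ k + (m : ℝ≥0∞)⁻¹ ≤ separationProb δ P k x y := by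
  rw [epsilon, csInf_lt_iff (bddBelow_epsilon k x) (insert_nonempty _ _)]
  constructor
  · rintro ⟨r, rfl | ⟨-, hsup⟩, hra⟩
    · exact Or.inl hra
    · obtain ⟨q, hrq, hqa⟩ := exists_rat_btwn hra
      obtain ⟨y, hy⟩ := lt_iSup_iff.1 hsup
      obtain ⟨hyr, hy⟩ := lt_iSup_iff.1 hy
      obtain ⟨m, hm⟩ := ENNReal.exists_inv_nat_lt (tsub_pos_of_lt hy).ne'
      refine Or.inr ⟨q, hqa, m, y, (Metric.mem_closedBall.1 hyr).trans hrq.le, ?_⟩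
      calc _ ≤ 2⁻¹ ^ k + (separationProb δ P k x y - 2⁻¹ ^ k) := by gcongr
        _ = separationProb δ P k x y := add_tsub_cancel_of_le hy.le
  · rintro (h | ⟨q, hqa, m, y, hyq, hy⟩)
    · exact ⟨_, mem_insert _ _, h⟩
    · obtain ⟨r, hqr, hra⟩ := exists_between hqa
      refine ⟨r, mem_insert_of_mem _ ⟨(dist_nonneg.trans hyq).trans_lt hqr, ?_⟩, hra⟩
      have hlt : (2⁻¹ : ℝ≥0∞) ^ k < 2⁻¹ ^ k + (m : ℝ≥0∞)⁻¹ :=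
        ENNReal.lt_add_right (ENNReal.pow_ne_top (by simp)) (by simp)
      exact (hlt.trans_le hy).trans_le (le_iSup₂_of_le (f := fun y _ => separationProb δ P k x y) y
        (hyq.trans hqr.le) le_rfl)

end Epsilon

theorem IsFlowWithSkeleton.epsilon_pos [IsProbabilityMeasure μ]
    (h : IsFlowWithSkeleton P μ ψ D Φ) (hδ : IsCompatibleDist δ) (k : ℕ) (x : M) :
    0 < epsilon δ P k x := by
  have hev : ∀ᶠ y in 𝓝 x, separationProb δ P k x y < 2⁻¹ ^ k := by
    have h1 : ∀ᶠ p in 𝓝 (x, x), ¬ 2⁻¹ ^ k ≤ separationProb δ P k p.1 p.2 :=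
      (h.isClosed_le_separationProb hδ k _).isOpen_compl.mem_nhds (by
        simp [h.separationProb_self hδ k x])
    exact ((Continuous.prodMk_right x).tendsto x).eventually h1 |>.mono fun y hy => not_le.1 hy
  obtain ⟨r, hr, hrs⟩ := Metric.eventually_nhds_iff.1 hev
  refine lt_of_lt_of_le (lt_min (by positivity : (0 : ℝ) < 2⁻¹ ^ k) hr)
    (le_csInf (insert_nonempty _ _) ?_)
  rintro a (rfl | ⟨ha, hsup⟩)
  · exact min_le_left _ _
  · refine (min_le_right _ _).trans ?_
    by_contra! hcon
    refine hsup.not_ge (iSup₂_le fun y hy => (hrs ?_).le)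
    exact (Metric.mem_closedBall.1 hy).trans_lt hcon

/-- The functions `ε_k` are measurable: the set `{ε_k < a}` is a countable union of projections of
closed subsets of the `σ`-compact space `M × M`. -/
theorem IsFlowWithSkeleton.measurable_epsilon [IsProbabilityMeasure μ]
    (h : IsFlowWithSkeleton P μ ψ D Φ) (hδ : IsCompatibleDist δ) (k : ℕ) :
    Measurable (epsilon δ P k) := by
  refine measurable_of_Iio fun a => ?_
  have hproj (q : ℚ) (m : ℕ) : MeasurableSet {x : M | ∃ y, dist y x ≤ q ∧
      2⁻¹ ^ k + (m : ℝ≥0∞)⁻¹ ≤ separationProb δ P k x y} := by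
    set F : Set (M × M) := {p | dist p.2 p.1 ≤ q} ∩
      {p | 2⁻¹ ^ k + (m : ℝ≥0∞)⁻¹ ≤ separationProb δ P k p.1 p.2} with hF
    have hFc : IsClosed F := (isClosed_le (by fun_prop) continuous_const).inter
      (h.isClosed_le_separationProb hδ k _)
    have : {x : M | ∃ y, dist y x ≤ q ∧ 2⁻¹ ^ k + (m : ℝ≥0∞)⁻¹ ≤ separationProb δ P k x y} =
        ⋃ j, Prod.fst '' (F ∩ compactCovering (M × M) j) := by
      rw [← image_iUnion, ← inter_iUnion, iUnion_compactCovering, inter_univ]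
      ext x
      simp [hF]
    rw [this]
    exact MeasurableSet.iUnion fun j =>
      (((isCompact_compactCovering _ j).inter_left hFc).image continuous_fst).measurableSet
  have hset : epsilon δ P k ⁻¹' Iio a = {x | (2⁻¹ : ℝ) ^ k < a} ∪ ⋃ (q : ℚ) (_ : (q : ℝ) < a) (m : ℕ),
      {x : M | ∃ y, dist y x ≤ q ∧ 2⁻¹ ^ k + (m : ℝ≥0∞)⁻¹ ≤ separationProb δ P k x y} := by
    ext x
    simp only [mem_preimage, mem_Iio, epsilon_lt_iff, mem_union, mem_ofPred_eq, mem_iUnion,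
      exists_prop]
  rw [hset]
  exact (MeasurableSet.const _).union (MeasurableSet.iUnion fun q => MeasurableSet.iUnion fun _ =>
    MeasurableSet.iUnion fun m => hproj q m)

end TwoPoint

/-! ### Measurability of `Θ` -/

theorem measurable_sInf_nat {α : Type*} {_ : MeasurableSpace α} {S : ℕ → Set α}
    (hS : ∀ n, MeasurableSet (S n)) : Measurable fun a => sInf {n | a ∈ S n} := by
  refine measurable_to_countable' fun n => ?_
  have : (fun a => sInf {n | a ∈ S n}) ⁻¹' {n} =
      (S n ∩ ⋂ m < n, (S m)ᶜ) ∪ {a | n = 0 ∧ a ∈ ⋂ m, (S m)ᶜ} := by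
    ext a
    simp only [mem_preimage, mem_singleton_iff, mem_union, mem_inter_iff, mem_iInter, mem_compl_iff,
      mem_ofPred_eq]
    constructor
    · rintro rfl
      by_cases h : ∃ m, a ∈ S m
      · exact Or.inl ⟨Nat.sInf_mem (s := {n | a ∈ S n}) h, fun m hm => Nat.notMem_of_lt_sInf hm⟩
      · push Not at h
        exact Or.inr ⟨by simp [h], h⟩
    · rintro (⟨h1, h2⟩ | ⟨rfl, h⟩)
      · refine le_antisymm (Nat.sInf_le h1) ?_
        by_contra! hlt
        exact h2 _ hlt (Nat.sInf_mem (s := {n | a ∈ S n}) ⟨n, h1⟩)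
      · simp [h]
  rw [this]
  refine ((hS n).inter (MeasurableSet.iInter fun m => MeasurableSet.iInter fun _ =>
    (hS m).compl)).union ?_
  exact (MeasurableSet.const _).inter (MeasurableSet.iInter fun m => (hS m).compl)

theorem measurable_apply_natIndex {α β : Type*} {_ : MeasurableSpace α} [MeasurableSpace β]
    {N : α → ℕ} (hN : Measurable N) {f : ℕ → α → β} (hf : ∀ n, Measurable (f n)) :
    Measurable fun a => f (N a) a :=
  (measurable_from_prod_countable_right (f := fun p : ℕ × α => f p.1 p.2) hf).comp
    (hN.prodMk measurable_id)

section Theta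

variable {M : Type*} [MetricSpace M] [LocallyCompactSpace M] [SecondCountableTopology M]
  [MeasurableSpace M] [BorelSpace M]
  {P : (n : ℕ) → ℝ≥0 → Kernel (Fin n → M) (Fin n → M)}
  {Ω : Type*} [MeasurableSpace Ω] {μ : Measure Ω} {ψ : ℝ → ℝ → Ω → MeasMap M}
  {Φ : Ω → ℕ → PathSpace M} {D : ℕ → ℝ × M}

omit [LocallyCompactSpace M] in
theorem measurable_Theta {ε : ℕ → M → ℝ} (hε : ∀ k, Measurable (ε k))
    {ℓ : (ℕ → PathSpace M) → PathSpace M} (hℓ : IsLimitPointSelection ℓ) (hΦ : Measurable Φ) :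
    Measurable fun p : ℝ × M × Ω => Theta ℓ ε p.1 p.2.1 (Φ p.2.2) := by
  have hpath (n : ℕ) : Measurable fun p : ℝ × M × Ω => Φ p.2.2 n :=
    (measurable_pi_apply n).comp (hΦ.comp (measurable_snd.comp measurable_snd))
  refine hℓ.measurable.comp (measurable_pi_lambda _ fun k => ?_)
  refine PathSpace.continuous_restrict.measurable.comp (Measurable.prodMk
    (measurable_apply_natIndex (measurable_sInf_nat fun n => ?_) hpath) measurable_fst)
  refine (measurableSet_le (PathSpace.continuous_start.measurable.comp (hpath n))
    measurable_fst).inter (measurableSet_lt (Measurable.dist ?_ ?_) ?_)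
  · exact PathSpace.continuous_ext_apply.measurable.comp ((hpath n).prodMk measurable_fst)
  · exact measurable_fst.comp measurable_snd
  · exact (hε k).comp (measurable_fst.comp measurable_snd)

theorem IsFlowWithSkeleton.measurable_theta [IsProbabilityMeasure μ]
    (h : IsFlowWithSkeleton P μ ψ D Φ) {δ : C(ℝ, M) → C(ℝ, M) → ℝ} (hδ : IsCompatibleDist δ)
    {ℓ : (ℕ → PathSpace M) → PathSpace M} (hℓ : IsLimitPointSelection ℓ) :
    Measurable fun p : (ℝ × ℝ) × M × Ω => theta δ P ℓ Φ p.1.1 p.1.2 p.2.2 p.2.1 := by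
  refine PathSpace.continuous_ext_apply.measurable.comp (Measurable.prodMk ?_
    (measurable_snd.comp measurable_fst))
  exact (measurable_Theta (h.measurable_epsilon hδ) hℓ h.version.measurable).comp
    ((measurable_fst.comp measurable_fst).prodMk measurable_snd)

/-! ### `θ` is a modification of the flow -/

omit [LocallyCompactSpace M] [SecondCountableTopology M] [BorelSpace M] in
/-- Up to null sets, a random path is obtained from its position at time `s` by the maps
`ψ_{s,t}`, `t ≥ s`. -/
theorem IsSkeletonVersion.ae_ext_eq {J : ℝ≥0 → MeasMap M × M → M}
    (hflow : ∀ s t u, s ≤ t → t ≤ u → ∀ x : M,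
      ∀ᵐ ω ∂μ, (ψ s u ω).1 x = J (u - t).toNNReal (ψ t u ω, (ψ s t ω).1 x))
    (hΦ : IsSkeletonVersion μ ψ D Φ) {s t : ℝ} (hst : s ≤ t) {n : ℕ} (hn : (D n).1 ≤ s) :
    ∀ᵐ ω ∂μ, (Φ ω n).ext t = J (t - s).toNNReal (ψ s t ω, (Φ ω n).ext s) := by
  filter_upwards [hΦ.ae_eq n s hn, hΦ.ae_eq n t (hn.trans hst), hflow _ _ _ hn hst (D n).2]
    with ω h1 h2 h3
  rw [h1, h2, h3]

/-- The `k`-th approximating path of `θ_{s,·}(x)` is separated from the trajectory `ψ_{s,·}(x)` with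
probability at most `2^{-k}`: its index and its position at time `s` depend on the past, its
evolution after `s` on the independent future, and this position is at distance less than `ε_k(x)`
from `x`. -/
theorem IsFlowWithSkeleton.measure_separated_le [IsProbabilityMeasure μ]
    (h : IsFlowWithSkeleton P μ ψ D Φ) {δ : C(ℝ, M) → C(ℝ, M) → ℝ} (hδ : IsCompatibleDist δ)
    {s : ℝ} {x : M} {Z : Ω → PathSpace M} (hZ : IsPathVersion μ ψ Φ s x Z) (k : ℕ) :
    μ {ω | (2⁻¹ : ℝ) ^ k ≤ δ (shiftPath s (Z ω))
      (shiftPath s (Φ ω (approxIndex (epsilon δ P) s x (Φ ω) k)))} ≤ 2⁻¹ ^ k := by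
  classical
  obtain ⟨J, hJ, hflow⟩ := h.flow.flow
  -- On the null set where `n_k` selects a path that starts after time `s`, `U` takes the value `x`.
  let N : Ω → ℕ := fun ω => approxIndex (epsilon δ P) s x (Φ ω) k
  let f : ℕ → Ω → M := fun n ω => if (D n).1 ≤ s then (Φ ω n).ext s else x
  let U : Ω → M := fun ω => f (N ω) ω
  have hstart := h.version.start_eq
  -- `U` is a random variable, and it is determined by the past; both follow from this statement.
  have hUm : ∀ m : MeasurableSpace Ω,
      (∀ n, (D n).1 ≤ s → Measurable[m] fun ω => (Φ ω n).ext s) → Measurable[m] U := by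
    intro m hm
    have hf (n : ℕ) : Measurable[m] (f n) := by
      by_cases hn : (D n).1 ≤ s
      · simpa only [f, if_pos hn] using hm n hn
      · simpa only [f, if_neg hn] using measurable_const
    refine measurable_apply_natIndex (measurable_sInf_nat (S := fun n =>
      {ω | (Φ ω n).start ≤ s ∧ dist ((Φ ω n).ext s) x < epsilon δ P k x}) fun n => ?_) hf
    by_cases hn : (D n).1 ≤ s
    · simp only [hstart, hn, true_and]
      exact hm n hn (Metric.isOpen_ball (x := x) (ε := epsilon δ P k x)).measurableSet
    · simp only [hstart, hn, false_and, ofPred_false, MeasurableSet.empty]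
  have hU : Measurable U := hUm _ fun n _ => (PathSpace.measurable_ext_apply_const s).comp
    ((measurable_pi_apply n).comp h.version.measurable)
  have hUpast : Measurable[past μ ψ s] U := hUm _ fun n hn =>
    EventuallyMeasurable.congr (measurable_past hn le_rfl (D n).2) (h.version.ae_eq n s hn)
  let V : Ω → ℕ → MeasMap M := fun ω l => ψ s (denseTime s l) ω
  have hV : Measurable V := measurable_pi_lambda _ fun l =>
    h.flow.measurable _ _ (le_denseTime s l)
  have hVfuture : Measurable[future μ ψ s] V := @measurable_pi_lambda _ _ _ (future μ ψ s) _ _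
    fun l => measurable_future le_rfl (le_denseTime s l)
  let q (l : ℕ) : ℝ≥0 := TopologicalSpace.denseSeq ℝ≥0 l
  have hq (l : ℕ) : (denseTime s l - s).toNNReal = q l := by simp [denseTime, q]
  obtain ⟨B, hB, hBS⟩ := exists_preimage_denseSeq (measurableSet_separatedSet hδ k)
  let C : Set (M × (ℕ → MeasMap M)) := {p | (fun l i => J (q l) (p.2 l, ![x, p.1] i)) ∈ B}
  have hC : MeasurableSet C := by
    refine measurable_pi_lambda _ (fun l => measurable_pi_lambda _ fun i => (hJ _).comp
      (((measurable_pi_apply l).comp measurable_snd).prodMk ?_)) hB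
    fin_cases i
    · exact measurable_const
    · exact measurable_fst
  have hZJ {y : M} {Z' : Ω → PathSpace M} (hZ' : IsPathVersion μ ψ Φ s y Z') :
      ∀ᵐ ω ∂μ, ∀ l, (Z' ω).ext (denseTime s l) = J (q l) (V ω l, y) := by
    refine ae_all_iff.2 fun l => ?_
    filter_upwards [hZ'.ae_eq _ (le_denseTime s l),
      (hflow s _ _ (le_denseTime s l) le_rfl y).1] with ω h1 h2
    rw [h1, ← h2, hq]
  -- `C` says that the paths driven by `V` from `x` and from `y` are separated: the Borel set of
  -- separated pairs of paths depends on their values at a dense set of times only.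
  have hmem {g₁ g₂ : PathSpace M} {y : M} {ω : Ω}
      (h1 : ∀ l, g₁.ext (denseTime s l) = J (q l) (V ω l, x))
      (h2 : ∀ l, g₂.ext (denseTime s l) = J (q l) (V ω l, y)) :
      (y, V ω) ∈ C ↔ (2⁻¹ : ℝ) ^ k ≤ δ (shiftPath s g₁) (shiftPath s g₂) := by
    have hrw : (fun l i => J (q l) (V ω l, ![x, y] i)) = fun l => pairPath s g₁ g₂ (q l) := by
      funext l i
      fin_cases i
      · exact (h1 l).symm
      · exact (h2 l).symm
    have hiff : pairPath s g₁ g₂ ∈ separatedSet δ k ↔ (fun l => pairPath s g₁ g₂ (q l)) ∈ B := by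
      rw [← hBS]; rfl
    change (fun l i => J (q l) (V ω l, ![x, y] i)) ∈ B ↔ _
    rw [hrw, ← hiff]
    rfl
  have hfrozen (y : M) : μ {ω | (y, V ω) ∈ C} = separationProb δ P k x y := by
    obtain ⟨Z', hZ'⟩ := exists_isPathVersion h.flow h.dense h.version h.skeleton s y
    rw [separationProb_eq h.feller h.flow hδ hZ hZ' k]
    refine measure_congr (eventuallyEq_set.2 ?_)
    filter_upwards [hZJ hZ, hZJ hZ'] with ω h1 h2 using hmem h1 h2
  have hspec : ∀ᵐ ω ∂μ, (D (N ω)).1 ≤ s ∧ U ω = (Φ ω (N ω)).ext s ∧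
      dist (U ω) x < epsilon δ P k x := by
    filter_upwards [h.skeleton] with ω hω
    have h1 := hω.approxIndex_spec (s := s) (h.epsilon_pos hδ k x)
    rw [hstart] at h1
    have h2 : U ω = (Φ ω (N ω)).ext s := if_pos h1.1
    exact ⟨h1.1, h2, h2 ▸ h1.2⟩
  have hΦJ : ∀ᵐ ω ∂μ, ∀ n l, (D n).1 ≤ s →
      (Φ ω n).ext (denseTime s l) = J (q l) (V ω l, (Φ ω n).ext s) := by
    refine ae_all_iff.2 fun n => ae_all_iff.2 fun l => ?_
    by_cases hn : (D n).1 ≤ s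
    · filter_upwards [h.version.ae_ext_eq (fun s t u hst htu x => (hflow s t u hst htu x).2)
        (le_denseTime s l) hn] with ω hω _
      rw [hω, hq]
    · exact Eventually.of_forall fun ω h' => absurd h' hn
  calc _ = μ {ω | (U ω, V ω) ∈ C} := by
        refine measure_congr (eventuallyEq_set.2 ?_)
        filter_upwards [hZJ hZ, hΦJ, hspec] with ω h1 h2 h3
        exact (hmem h1 fun l => by rw [h3.2.1]; exact h2 _ l h3.1).symm
    _ = ∫⁻ ω, μ {ω' | (U ω, V ω') ∈ C} ∂μ :=
        measure_eq_lintegral_of_indepFun hU hV (h.flow.indepFun hUpast hVfuture) hC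
    _ ≤ ∫⁻ _, 2⁻¹ ^ k ∂μ := by
        refine lintegral_mono_ae ?_
        filter_upwards [hspec] with ω hω
        rw [hfrozen]
        exact separationProb_le_of_dist_lt hω.2.2
    _ = 2⁻¹ ^ k := by simp

/-- By the Borel–Cantelli lemma the approximating paths converge to the trajectory of the flow. -/
theorem IsFlowWithSkeleton.theta_ae_eq [IsProbabilityMeasure μ]
    (h : IsFlowWithSkeleton P μ ψ D Φ) {δ : C(ℝ, M) → C(ℝ, M) → ℝ} (hδ : IsCompatibleDist δ)
    {ℓ : (ℕ → PathSpace M) → PathSpace M} (hℓ : IsLimitPointSelection ℓ) {s t : ℝ} (hst : s ≤ t)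
    (x : M) : ∀ᵐ ω ∂μ, theta δ P ℓ Φ s t ω x = (ψ s t ω).1 x := by
  obtain ⟨Z, hZ⟩ := exists_isPathVersion h.flow h.dense h.version h.skeleton s x
  have hBC := ae_eventually_notMem (μ := μ) (s := fun k => {ω | (2⁻¹ : ℝ) ^ k ≤
      δ (shiftPath s (Z ω)) (shiftPath s (Φ ω (approxIndex (epsilon δ P) s x (Φ ω) k)))}) (by
    refine ne_top_of_le_ne_top (b := ∑' k : ℕ, (2⁻¹ : ℝ≥0∞) ^ k) ?_
      (ENNReal.tsum_le_tsum fun k => h.measure_separated_le hδ hZ k)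
    rw [ENNReal.tsum_geometric, ENNReal.one_sub_inv_two, inv_inv]
    simp)
  filter_upwards [hBC, h.skeleton, hZ.ae_eq t hst] with ω h1 h2 h3
  rw [← h3]
  refine h2.Theta_ext_eq (fun k => h.epsilon_pos hδ k x) (fun k => epsilon_le k x) hℓ hst ?_
  have hlim : Tendsto (fun k => shiftPath s (Φ ω (approxIndex (epsilon δ P) s x (Φ ω) k))) atTop
      (𝓝 (shiftPath s (Z ω))) := by
    refine (hδ.nhds_basis _).tendsto_right_iff.2 fun r hr => ?_
    have hpow : ∀ᶠ k : ℕ in atTop, (2⁻¹ : ℝ) ^ k < r :=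
      (tendsto_pow_atTop_nhds_zero_of_lt_one (by norm_num) (by norm_num)).eventually_lt_const hr
    filter_upwards [h1, hpow] with k hk1 hk2
    rw [hδ.symm]
    exact (not_le.1 hk1).trans hk2
  have heval := ((continuous_eval_const (F := C(ℝ, M)) (t - s)).tendsto _).comp hlim
  simpa only [Function.comp_def, shiftPath_apply_sub hst] using heval

end Theta

end StochFlow

open StochFlow
theorem mainTheorem2
    {M : Type*} [MetricSpace M] [LocallyCompactSpace M] [TopologicalSpace.SeparableSpace M]
    [MeasurableSpace M] [BorelSpace M]
    -- the transition functions
    (P : (n : ℕ) → ℝ≥0 → Kernel (Fin n → M) (Fin n → M))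
    (hFeller : ∀ n, IsFeller (P n))
    (hConsistent : IsConsistent P) (hCoalescing : IsCoalescing P) (hContinuous : HasContinuousTrajectories P)
    -- an associated stochastic flow of measurable mappings
    {Ω : Type*} [MeasurableSpace Ω] (μ : Measure Ω) [IsProbabilityMeasure μ]
    (ψ : ℝ → ℝ → Ω → MeasMap M) (hψ : IsStochasticFlow P μ ψ)
    -- a dense sequence and the random sequence of paths that start from it, a.s. a skeleton
    (D : ℕ → ℝ × M) (hD : DenseRange D)
    (Φ : Ω → ℕ → PathSpace M) (hΦ : IsSkeletonVersion μ ψ D Φ)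
    (hSkeleton : ∀ᵐ φ ∂(μ.map Φ), IsSkeleton φ)
    -- the distance on paths and the measurable limit-point selection that are fixed
    (δ : C(ℝ, M) → C(ℝ, M) → ℝ) (hδ : IsCompatibleDist δ)
    (ℓ : (ℕ → PathSpace M) → PathSpace M) (hℓ : IsLimitPointSelection ℓ) :
    (∃ Ω₀ : Set Ω, MeasurableSet Ω₀ ∧ μ Ω₀ = 1 ∧ ∀ ω ∈ Ω₀, IsSkeleton (Φ ω)) ∧
    ∀ Ω₀ : Set Ω, MeasurableSet Ω₀ → μ Ω₀ = 1 → (∀ ω ∈ Ω₀, IsSkeleton (Φ ω)) →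
      IsMeasurableContinuousModification (μ.comap (Subtype.val : Ω₀ → Ω))
        (fun s t (ω : Ω₀) x => theta δ P ℓ Φ s t ω.1 x) (fun s t (ω : Ω₀) => ψ s t ω.1) ∧
      ∀ ω : Ω₀, PreservesSkeleton (fun s t x => theta δ P ℓ Φ s t ω.1 x) (Φ ω.1) := by
  have : SecondCountableTopology M := UniformSpace.secondCountable_of_separable M
  have hsk : ∀ᵐ ω ∂μ, IsSkeleton (Φ ω) := ae_of_ae_map hΦ.measurable.aemeasurable hSkeleton
  have h : IsFlowWithSkeleton P μ ψ D Φ := ⟨hFeller, hψ, hD, hΦ, hsk⟩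
  refine ⟨?_, fun Ω₀ hΩ₀ hμΩ₀ hskel => ?_⟩
  · obtain ⟨Ω₀, h1, h2, h3⟩ := Eventually.exists_measurable_mem hsk
    exact ⟨Ω₀, h2, (mem_ae_iff_prob_eq_one h2).1 h1, h3⟩
  have hpres (ω : Ω₀) : PreservesSkeleton (fun s t x => theta δ P ℓ Φ s t ω.1 x) (Φ ω.1) :=
    (hskel ω.1 ω.2).preservesSkeleton (fun k x => h.epsilon_pos hδ k x)
      (fun k x => epsilon_le k x) hℓ
  have hmeas := h.measurable_theta hδ hℓ
  refine ⟨⟨fun s t _ ω => ?_, fun s t _ x => ?_, fun s ω x => (hpres ω).refl s x,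
    fun s t hst x => ?_, ?_, fun s ω x => ?_⟩, hpres⟩
  · exact hmeas.comp (measurable_const.prodMk (measurable_id.prodMk measurable_const) :
      Measurable fun x : M => ((s, t), x, ω.1))
  · exact hmeas.comp (measurable_const.prodMk (measurable_const.prodMk measurable_subtype_coe) :
      Measurable fun ω : Ω₀ => ((s, t), x, ω.1))
  · exact (ae_restrict_iff_subtype hΩ₀).1 (ae_restrict_of_ae (h.theta_ae_eq hδ hℓ hst x))
  · exact hmeas.comp ((measurable_subtype_coe.comp measurable_fst).prodMk
      ((measurable_fst.comp measurable_snd).prodMk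
        (measurable_subtype_coe.comp (measurable_snd.comp measurable_snd))))
  · exact (map_continuous (Theta ℓ (epsilon δ P) s x (Φ ω.1)).ext).continuousOn
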